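/- Let $d\ge 0$ be an integer, let $P_X$ be a probability measure on $\mathbb R^d$, and let $g(x,\beta)=e^{x^T\beta}/(1+e^{x^T\beta})$ for $x,\beta\in\mathbb R^d$. On a probability space $(\Omega,\mathcal F,\mathbb P)$ let $\beta_0$ be an $\mathbb R^d$-valued random vector and let $((X_n,Y_n))_{n\ge1}$ be random variables with values in $\mathbb R^d\times\{0,1\}$. Define recursively $$\beta_n=\beta_{n-1}+\frac{1}{n\log 2}\,\bigl(Y_n-g(X_n,\beta_{n-1})\bigr)X_n,\qquad n\ge 1,$$ and suppose that, for every $n\ge0$ and $y\in\{0,1\}$, $\mathbb P$-a.s., $$\mathbb P(X_{n+1}\in dx,\,Y_{n+1}=y\mid \beta_0,X_1,Y_1,\dots,X_n,Y_n)=g(x,\beta_n)^y\,(1-g(x,\beta_n))^{1-y}\,P_X(dx).$$ Assume that $E(\|\beta_0\|^2)<\infty$, that $P_X$ has bounded support, and that $P_X$ is not concentrated on any proper linear subspace, i.e. $P_X(L)<1$ for every linear subspace $L\subsetneq\mathbb R^d$. Then $(\beta_n)_{n\ge0}$ converges $\mathbb P$-a.s. to a random vector $\tilde\beta$, and, for $\mathbb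 P$-almost every $\omega$, the (regular) conditional distribution of $\sqrt n(\tilde\beta-\beta_n)$ given $\beta_0,X_1,Y_1,\dots,X_n,Y_n$, evaluated at $\omega$, converges weakly, as $n\to\infty$, to the multivariate normal distribution $\mathcal N(0,U(\omega))$, where $$U=(\log 2)^{-2}\int x x^T g(x,\tilde\beta)\bigl(1-g(x,\tilde\beta)\bigr)\,P_X(dx).$$ -/

import Mathlib

open MeasureTheory ProbabilityTheory Filter Topology

noncomputable section

namespace OnlineGradient

/-- Feature space `ℝ^d` with its Euclidean structure. -/
abbrev Vec (d : ℕ) : Type := EuclideanSpace ℝ (Fin d)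

/-- The logistic function `g(x, β) = exp(xᵀβ) / (1 + exp(xᵀβ))`. -/
def logistic {d : ℕ} (x b : Vec d) : ℝ :=
  Real.exp (inner ℝ x b) / (1 + Real.exp (inner ℝ x b))

/-- The online gradient descent iterates `β_0, β_1, …`, where
`β_n = β_{n-1} + (n log 2)⁻¹ (Y_n - g(X_n, β_{n-1})) X_n` for `n ≥ 1`.
The observations are `(X_n, Y_n)`, `n ≥ 1`; the values `X 0` and `Y 0` are never used. -/
def iterate {d : ℕ} {Ω : Type*} (β₀ : Ω → Vec d) (X : ℕ → Ω → Vec d) (Y : ℕ → Ω → Fin 2) :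
    ℕ → Ω → Vec d
  | 0, ω => β₀ ω
  | n + 1, ω => iterate β₀ X Y n ω +
      (1 / (((n + 1 : ℕ) : ℝ) * Real.log 2) *
        (((Y (n + 1) ω : ℕ) : ℝ) - logistic (X (n + 1) ω) (iterate β₀ X Y n ω))) • X (n + 1) ω

/-- The data up to time `n`: `(β_0, (X_1, Y_1), …, (X_n, Y_n))`. -/
def history {d : ℕ} {Ω : Type*} (β₀ : Ω → Vec d) (X : ℕ → Ω → Vec d) (Y : ℕ → Ω → Fin 2)
    (n : ℕ) (ω : Ω) : Vec d × (Fin n → Vec d × Fin 2) :=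
  (β₀ ω, fun i => (X (i + 1) ω, Y (i + 1) ω))

/-- The measure `g(x, b)^y (1 - g(x, b))^(1 - y) P_X(dx)` on pairs `(x, y)`, `y ∈ {0, 1}`. -/
def predictiveLaw {d : ℕ} (PX : Measure (Vec d)) (b : Vec d) : Measure (Vec d × Fin 2) :=
  (PX.prod Measure.count).withDensity fun z =>
    ENNReal.ofReal (logistic z.1 b ^ (z.2 : ℕ) * (1 - logistic z.1 b) ^ (1 - (z.2 : ℕ)))

/-- The predictive rule: for every `n ≥ 0`, the conditional law of `(X_{n+1}, Y_{n+1})` given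
`β_0, X_1, Y_1, …, X_n, Y_n` is `g(x, β_n)^y (1 - g(x, β_n))^(1 - y) P_X(dx)`, where `β_n` is the
`n`-th online gradient descent iterate. -/
def FollowsPredictiveRule {d : ℕ} {Ω : Type*} [MeasurableSpace Ω] (P : Measure Ω)
    [IsFiniteMeasure P] (PX : Measure (Vec d)) (β₀ : Ω → Vec d) (X : ℕ → Ω → Vec d)
    (Y : ℕ → Ω → Fin 2) : Prop :=
  ∀ n : ℕ, ∀ᵐ ω ∂P,
    condDistrib (fun ω' => (X (n + 1) ω', Y (n + 1) ω')) (history β₀ X Y n) P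
      (history β₀ X Y n ω) = predictiveLaw PX (iterate β₀ X Y n ω)

/-- The matrix `(log 2)⁻² ∫ x xᵀ g(x, b) (1 - g(x, b)) P_X(dx)`. -/
def asympCov {d : ℕ} (PX : Measure (Vec d)) (b : Vec d) : Matrix (Fin d) (Fin d) ℝ :=
  Matrix.of fun i j =>
    (Real.log 2 ^ 2)⁻¹ * ∫ x, x i * x j * (logistic x b * (1 - logistic x b)) ∂PX

/-- The conditional distribution (regular version, evaluated along `ω`) of `√n (β̃ - β_n)` given
`β_0, X_1, Y_1, …, X_n, Y_n`. -/
def scaledErrorLaw {d : ℕ} {Ω : Type*} [MeasurableSpace Ω] (P : Measure Ω) [IsFiniteMeasure P]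
    (β₀ : Ω → Vec d) (X : ℕ → Ω → Vec d) (Y : ℕ → Ω → Fin 2) (βlim : Ω → Vec d)
    (n : ℕ) (ω : Ω) : ProbabilityMeasure (Vec d) :=
  ⟨condDistrib (fun ω' => Real.sqrt n • (βlim ω' - iterate β₀ X Y n ω')) (history β₀ X Y n) P
    (history β₀ X Y n ω), inferInstance⟩

/-- The centred multivariate normal law `N(0, S)` (`S` positive semidefinite). -/
def normalLaw {d : ℕ} (S : Matrix (Fin d) (Fin d) ℝ) : ProbabilityMeasure (Vec d) :=
  ⟨multivariateGaussian 0 S, inferInstance⟩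

end OnlineGradient

end

noncomputable section

namespace OnlineGradient

/-! ### The logistic function -/

/-! Write `ξ` for the unscaled increment. Given the data up to time `N`, the response is Bernoulli
with the very parameter `g(X, β_N)` that the algorithm subtracts, so `ξ` is centred and the iterates
form a martingale. Its steps are a.s. at most `ρ / (N + 1)` with `ρ = R / log 2`, where `R` bounds
the support of `P_X`. Square summability of the steps bounds the martingale in `L¹`, and Doob's
theorem, applied to each coordinate, gives the limit.

For the conditional central limit theorem, fix `n` and a direction `t`, and let `N` run from `n` to
infinity. `dampedPhase` multiplies `exp(i √n ⟨β_N - β_n, t⟩)` by a Gaussian damping that uses up the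
fraction `n / N` of the variance `v_t(β_n)`. Passing from `N` to `N + 1` multiplies the phase by a
factor with conditional mean close to `exp(-v_t(β_N) τ / 2)`, where `τ = n / N - n / (N + 1)`, and
the change in damping compensates for `exp(-v_t(β_n) τ / 2)`. By
`norm_integral_exp_increment_sub_exp_le` the mismatch is `τ · O(1 / √n + ‖β_N - β_n‖)`, and the
displacement is itself `O(1 / √n)` in conditional mean. Since the `τ` sum to at most `1`, the total
error is `O(1 / √n)`, uniformly in `N`.

All these estimates are integrated against arbitrary bounded weights `w` known at time `n`. Hence
they say something about the conditional characteristic function at almost every `ω`, not just in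
the mean: `ae_norm_le_of_forall_norm_integral_mul_le` converts one form into the other. Convergence
of `β_n` and Lévy's continuity theorem finish the proof. -/

theorem logistic_eq_sigmoid {d : ℕ} (x b : Vec d) : logistic x b = Real.sigmoid (inner ℝ x b) := by
  rw [logistic, Real.sigmoid_def, Real.exp_neg]
  have := Real.exp_pos (inner ℝ x b)
  field_simp
  ring

theorem logistic_nonneg {d : ℕ} (x b : Vec d) : 0 ≤ logistic x b := by
  rw [logistic_eq_sigmoid]; exact Real.sigmoid_nonneg _

theorem logistic_le_one {d : ℕ} (x b : Vec d) : logistic x b ≤ 1 := by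
  rw [logistic_eq_sigmoid]; exact Real.sigmoid_le_one _

@[fun_prop]
theorem measurable_logistic {d : ℕ} {α : Type*} {mα : MeasurableSpace α} {f g : α → Vec d}
    (hf : Measurable f) (hg : Measurable g) : Measurable fun a => logistic (f a) (g a) := by
  unfold logistic
  fun_prop

theorem abs_sigmoid_sub_le (u v : ℝ) : |Real.sigmoid u - Real.sigmoid v| ≤ |u - v| := by
  have h := Convex.norm_image_sub_le_of_norm_hasDerivWithin_le (f := Real.sigmoid)
    (f' := fun x => Real.sigmoid x * (1 - Real.sigmoid x)) (C := 1) (s := Set.univ) (x := v) (y := u)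
    (fun x _ => (Real.hasDerivAt_sigmoid x).hasDerivWithinAt)
    (fun x _ => by
      have h0 := Real.sigmoid_nonneg x
      have h1 := Real.sigmoid_le_one x
      rw [Real.norm_eq_abs, abs_of_nonneg (mul_nonneg h0 (by linarith))]
      nlinarith) convex_univ (Set.mem_univ _) (Set.mem_univ _)
  simpa using h

theorem abs_logistic_variance_sub_le {d : ℕ} (x b c : Vec d) :
    |logistic x b * (1 - logistic x b) - logistic x c * (1 - logistic x c)| ≤ ‖x‖ * ‖b - c‖ := by
  have h1 : |logistic x b - logistic x c| ≤ ‖x‖ * ‖b - c‖ := by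
    rw [logistic_eq_sigmoid, logistic_eq_sigmoid]
    refine (abs_sigmoid_sub_le _ _).trans ?_
    rw [← inner_sub_right]
    exact abs_real_inner_le_norm _ _
  have h2 : |1 - logistic x b - logistic x c| ≤ 1 := by
    rw [abs_le]
    constructor <;> linarith [logistic_nonneg x b, logistic_le_one x b, logistic_nonneg x c,
      logistic_le_one x c]
  calc _ = |(logistic x b - logistic x c) * (1 - logistic x b - logistic x c)| := by
        congr 1; ring
    _ ≤ (‖x‖ * ‖b - c‖) * 1 := by
        rw [abs_mul]; gcongr
    _ = _ := mul_one _

/-! ### Elementary bounds for the exponential -/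

/-- Taylor's bound covers `|u| ≤ 1`; for larger `|u|` every term is dominated by `|u| ^ 3`. The
constant is crude, but no smallness of `u` is required. -/
theorem norm_exp_mul_I_sub_quadratic_le (u : ℝ) :
    ‖Complex.exp (u * Complex.I) - (1 + u * Complex.I - u ^ 2 / 2)‖ ≤ 4 * |u| ^ 3 := by
  have hu : ‖(u * Complex.I : ℂ)‖ = |u| := by simp
  rcases le_total |u| 1 with h | h
  · have := Complex.exp_bound (x := u * Complex.I) (by rw [hu]; exact h) (n := 3) (by norm_num)
    rw [hu] at this
    simp only [Finset.sum_range_succ, Finset.sum_range_zero, Nat.factorial] at this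
    norm_num [mul_pow] at this
    have h3 : 0 ≤ |u| ^ 3 := by positivity
    calc _ = ‖Complex.exp (u * Complex.I) - (1 + u * Complex.I + -(u : ℂ) ^ 2 / 2)‖ := by
          congr 1; ring
      _ ≤ _ := this
      _ ≤ _ := by linarith
  · have h2 : |u| ≤ |u| ^ 3 := by nlinarith [sq_nonneg |u|, abs_nonneg u]
    have h3 : |u| ^ 2 ≤ |u| ^ 3 := by nlinarith [sq_nonneg |u|, abs_nonneg u]
    calc _ ≤ ‖Complex.exp (u * Complex.I)‖ + ‖(1 + u * Complex.I - u ^ 2 / 2 : ℂ)‖ :=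
          norm_sub_le _ _
      _ ≤ 1 + (1 + |u| + |u| ^ 2 / 2) := by
          gcongr
          · rw [Complex.norm_exp_ofReal_mul_I]
          · refine (norm_sub_le _ _).trans ?_
            gcongr
            · refine (norm_add_le _ _).trans ?_
              simp
            · simp
      _ ≤ _ := by linarith

theorem abs_one_sub_sub_exp_neg_le {x : ℝ} (hx : 0 ≤ x) : |1 - x - Real.exp (-x)| ≤ x ^ 2 := by
  rcases le_total x 1 with h | h
  · have := Real.abs_exp_sub_one_sub_id_le (x := -x) (by rwa [abs_neg, abs_of_nonneg hx])
    rw [abs_sub_comm]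
    convert! this using 1
    · congr 1; ring
    · ring
  · have h1 := Real.add_one_le_exp (-x)
    have h2 : Real.exp (-x) ≤ 1 := by simpa using hx
    rw [abs_le]
    constructor <;> nlinarith

/-! ### The predictive law -/

/-- The unscaled step `(log 2)⁻¹ (y - g(x, b)) x` of the algorithm at `b` for the datum `(x, y)`. -/
def increment {d : ℕ} (b : Vec d) (z : Vec d × Fin 2) : Vec d :=
  (1 / Real.log 2 * (((z.2 : ℕ) : ℝ) - logistic z.1 b)) • z.1

/-- The conditional variance of `⟨increment, t⟩` at `b`. -/
def stepVariance {d : ℕ} (PX : Measure (Vec d)) (t b : Vec d) : ℝ :=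
  (Real.log 2 ^ 2)⁻¹ * ∫ x, inner ℝ x t ^ 2 * (logistic x b * (1 - logistic x b)) ∂PX

@[fun_prop]
theorem measurable_increment {d : ℕ} {α : Type*} {mα : MeasurableSpace α} {f : α → Vec d}
    {g : α → Vec d × Fin 2} (hf : Measurable f) (hg : Measurable g) :
    Measurable fun a => increment (f a) (g a) := by
  have : Measurable fun y : Fin 2 => ((y : ℕ) : ℝ) := measurable_from_top
  have h2 : Measurable fun a => (((g a).2 : ℕ) : ℝ) := this.comp hg.snd
  unfold increment
  fun_prop

theorem norm_increment_le {d : ℕ} (b : Vec d) (z : Vec d × Fin 2) :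
    ‖increment b z‖ ≤ 1 / Real.log 2 * ‖z.1‖ := by
  have hlog : 0 < Real.log 2 := Real.log_pos (by norm_num)
  have h : |((z.2 : ℕ) : ℝ) - logistic z.1 b| ≤ 1 := by
    have h0 := logistic_nonneg z.1 b
    have h1 := logistic_le_one z.1 b
    have h2 : ((z.2 : ℕ) : ℝ) ≤ 1 := by exact_mod_cast Nat.le_of_lt_succ z.2.2
    have h3 : (0 : ℝ) ≤ ((z.2 : ℕ) : ℝ) := by positivity
    rw [abs_le]
    constructor <;> linarith
  rw [increment, norm_smul, norm_mul, Real.norm_eq_abs, Real.norm_eq_abs,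
    abs_of_pos (by positivity : 0 < 1 / Real.log 2)]
  gcongr
  exact mul_le_of_le_one_right (by positivity) h

theorem iterate_succ {d : ℕ} {Ω : Type*} (β₀ : Ω → Vec d) (X : ℕ → Ω → Vec d)
    (Y : ℕ → Ω → Fin 2) (n : ℕ) (ω : Ω) :
    iterate β₀ X Y (n + 1) ω = iterate β₀ X Y n ω +
      (1 / ((n : ℝ) + 1)) • increment (iterate β₀ X Y n ω) (X (n + 1) ω, Y (n + 1) ω) := by
  rw [iterate, increment, smul_smul]
  congr 2
  push_cast
  rw [one_div_mul_eq_div, one_div_mul_eq_div, one_div_mul_eq_div, div_div, mul_comm]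

section PredictiveLaw

variable {d : ℕ} (PX : Measure (Vec d)) [IsProbabilityMeasure PX] {R : ℝ}

theorem predictiveLaw_density_le_one (b : Vec d) (z : Vec d × Fin 2) :
    logistic z.1 b ^ (z.2 : ℕ) * (1 - logistic z.1 b) ^ (1 - (z.2 : ℕ)) ≤ 1 :=
  mul_le_one₀ (pow_le_one₀ (logistic_nonneg _ _) (logistic_le_one _ _))
    (pow_nonneg (by linarith [logistic_le_one z.1 b]) _)
    (pow_le_one₀ (by linarith [logistic_le_one z.1 b]) (by linarith [logistic_nonneg z.1 b]))

theorem measurable_predictiveLaw_density (b : Vec d) : Measurable fun z : Vec d × Fin 2 =>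
    logistic z.1 b ^ (z.2 : ℕ) * (1 - logistic z.1 b) ^ (1 - (z.2 : ℕ)) := by
  refine measurable_from_prod_countable_left fun y => ?_
  dsimp only
  fun_prop

instance isFiniteMeasure_predictiveLaw (b : Vec d) : IsFiniteMeasure (predictiveLaw PX b) := by
  refine isFiniteMeasure_withDensity (ne_top_of_le_ne_top (b := ∫⁻ _ : Vec d × Fin 2, 1 ∂(PX.prod Measure.count)) ?_ ?_)
  · rw [lintegral_one]; exact measure_ne_top _ _
  · refine lintegral_mono fun z => ?_
    exact ENNReal.ofReal_le_one.2 (predictiveLaw_density_le_one b z)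

omit [IsProbabilityMeasure PX] in
theorem ae_predictiveLaw_of_ae {p : Vec d → Prop} (hp : ∀ᵐ x ∂PX, p x) (b : Vec d) :
    ∀ᵐ z ∂predictiveLaw PX b, p z.1 :=
  (withDensity_absolutelyContinuous _ _).ae_le (Measure.quasiMeasurePreserving_fst.ae hp)

/-- Fubini for `P_X` times counting measure: the density puts weight `1 - g` on the response `0` and
`g` on the response `1`. -/
theorem integral_predictiveLaw {E : Type*} [NormedAddCommGroup E] [NormedSpace ℝ E]
    [CompleteSpace E] {G : Vec d × Fin 2 → E} (hG : StronglyMeasurable G)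
    {C : ℝ} (hC : ∀ᵐ x ∂PX, ∀ y, ‖G (x, y)‖ ≤ C) (b : Vec d) :
    ∫ z, G z ∂predictiveLaw PX b =
      ∫ x, ((1 - logistic x b) • G (x, 0) + logistic x b • G (x, 1)) ∂PX := by
  have h0 (z : Vec d × Fin 2) :
      0 ≤ logistic z.1 b ^ (z.2 : ℕ) * (1 - logistic z.1 b) ^ (1 - (z.2 : ℕ)) :=
    mul_nonneg (pow_nonneg (logistic_nonneg _ _) _)
      (pow_nonneg (by linarith [logistic_le_one z.1 b]) _)
  rw [predictiveLaw, integral_withDensity_eq_integral_toReal_smul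
    (measurable_predictiveLaw_density b).ennreal_ofReal (by simp)]
  simp_rw [ENNReal.toReal_ofReal (h0 _)]
  rw [integral_prod]
  · refine integral_congr_ae (ae_of_all _ fun x => ?_)
    dsimp only
    rw [integral_fintype .of_finite]
    simp [Fin.sum_univ_two]
  · refine Integrable.of_bound
      ((measurable_predictiveLaw_density b).stronglyMeasurable.smul hG).aestronglyMeasurable C ?_
    filter_upwards [Measure.quasiMeasurePreserving_fst.ae hC] with z hz
    rw [norm_smul, Real.norm_eq_abs, abs_of_nonneg (h0 z)]
    exact (mul_le_of_le_one_left (norm_nonneg _) (predictiveLaw_density_le_one b z)).trans (hz z.2)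

instance isProbabilityMeasure_predictiveLaw (b : Vec d) :
    IsProbabilityMeasure (predictiveLaw PX b) := by
  have h := integral_predictiveLaw PX (G := fun _ => (1 : ℝ)) stronglyMeasurable_const (C := 1)
    (by simp) b
  simp only [integral_const, smul_eq_mul, mul_one, sub_add_cancel, probReal_univ] at h
  exact isProbabilityMeasure_iff_real.2 h

variable {PX}

omit [IsProbabilityMeasure PX] in
theorem ae_norm_increment_le (hR : ∀ᵐ x ∂PX, ‖x‖ ≤ R) (b c : Vec d) :
    ∀ᵐ z ∂predictiveLaw PX b, ‖increment c z‖ ≤ 1 / Real.log 2 * R := by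
  have hlog : 0 < Real.log 2 := Real.log_pos (by norm_num)
  filter_upwards [ae_predictiveLaw_of_ae PX hR b] with z hz
  exact (norm_increment_le c z).trans (by gcongr)

theorem abs_inner_increment_le {ρ : ℝ} {b t : Vec d} {z : Vec d × Fin 2}
    (hz : ‖increment b z‖ ≤ ρ) : |inner ℝ (increment b z) t| ≤ ρ * ‖t‖ :=
  (abs_real_inner_le_norm _ _).trans (by gcongr)

/-- The response has conditional mean `g(x, b)` given `x`, exactly the amount subtracted in
`increment b`. It matters that the law and the increment use the same `b`; this is the source of the
martingale property. -/
theorem integral_inner_increment (hR : ∀ᵐ x ∂PX, ‖x‖ ≤ R) (b t : Vec d) :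
    ∫ z, inner ℝ (increment b z) t ∂predictiveLaw PX b = 0 := by
  have hlog : 0 < Real.log 2 := Real.log_pos (by norm_num)
  rw [integral_predictiveLaw PX (C := 1 / Real.log 2 * R * ‖t‖)
    (by fun_prop : Measurable _).stronglyMeasurable]
  · refine integral_eq_zero_of_ae (ae_of_all _ fun x => ?_)
    simp [increment, inner_smul_left]
    ring
  · filter_upwards [hR] with x hx y
    exact abs_inner_increment_le ((norm_increment_le b (x, y)).trans (by simp only; gcongr))

theorem integral_inner_increment_sq (hR : ∀ᵐ x ∂PX, ‖x‖ ≤ R) (b t : Vec d) :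
    ∫ z, inner ℝ (increment b z) t ^ 2 ∂predictiveLaw PX b = stepVariance PX t b := by
  have hlog : 0 < Real.log 2 := Real.log_pos (by norm_num)
  rw [integral_predictiveLaw PX (C := (1 / Real.log 2 * R * ‖t‖) ^ 2)
    (by fun_prop : Measurable _).stronglyMeasurable, stepVariance, ← integral_const_mul]
  · refine integral_congr_ae (ae_of_all _ fun x => ?_)
    simp [increment, inner_smul_left]
    ring
  · filter_upwards [hR] with x hx y
    rw [norm_pow]
    gcongr
    exact abs_inner_increment_le ((norm_increment_le b (x, y)).trans (by simp only; gcongr))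

end PredictiveLaw

/-! ### The one-step variance and the one-step characteristic function -/

section StepVariance

variable {d : ℕ} {PX : Measure (Vec d)} [IsProbabilityMeasure PX] {R : ℝ}

theorem logistic_variance_nonneg (x b : Vec d) : 0 ≤ logistic x b * (1 - logistic x b) :=
  mul_nonneg (logistic_nonneg x b) (by linarith [logistic_le_one x b])

theorem logistic_variance_le_one (x b : Vec d) : logistic x b * (1 - logistic x b) ≤ 1 :=
  mul_le_one₀ (logistic_le_one x b) (by linarith [logistic_le_one x b])
    (by linarith [logistic_nonneg x b])

omit [IsProbabilityMeasure PX] in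
theorem stepVariance_nonneg (t b : Vec d) : 0 ≤ stepVariance PX t b :=
  mul_nonneg (by positivity)
    (integral_nonneg fun x => mul_nonneg (sq_nonneg _) (logistic_variance_nonneg x b))

theorem inner_sq_le {x : Vec d} (hx : ‖x‖ ≤ R) (t : Vec d) : inner ℝ x t ^ 2 ≤ (R * ‖t‖) ^ 2 :=
  sq_le_sq' (by linarith [neg_abs_le (inner ℝ x t), abs_real_inner_le_norm x t,
    mul_le_mul_of_nonneg_right hx (norm_nonneg t)])
    ((real_inner_le_norm _ _).trans (by gcongr))

theorem integrable_stepVariance (hR : ∀ᵐ x ∂PX, ‖x‖ ≤ R) (t b : Vec d) :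
    Integrable (fun x => inner ℝ x t ^ 2 * (logistic x b * (1 - logistic x b))) PX := by
  refine Integrable.of_bound (by fun_prop) ((R * ‖t‖) ^ 2) ?_
  filter_upwards [hR] with x hx
  rw [norm_mul, Real.norm_of_nonneg (sq_nonneg _), Real.norm_of_nonneg (logistic_variance_nonneg x b)]
  exact (mul_le_of_le_one_right (sq_nonneg _) (logistic_variance_le_one x b)).trans
    (inner_sq_le hx t)

theorem stepVariance_le (hR : ∀ᵐ x ∂PX, ‖x‖ ≤ R) (t b : Vec d) :
    stepVariance PX t b ≤ (1 / Real.log 2 * R * ‖t‖) ^ 2 := by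
  have h : ∫ x, inner ℝ x t ^ 2 * (logistic x b * (1 - logistic x b)) ∂PX ≤ (R * ‖t‖) ^ 2 := by
    calc _ ≤ ∫ x, (R * ‖t‖) ^ 2 ∂PX := by
          refine integral_mono_ae (integrable_stepVariance hR t b) (integrable_const _) ?_
          filter_upwards [hR] with x hx
          exact (mul_le_of_le_one_right (sq_nonneg _) (logistic_variance_le_one x b)).trans
            (inner_sq_le hx t)
      _ = _ := by simp
  calc _ ≤ (Real.log 2 ^ 2)⁻¹ * (R * ‖t‖) ^ 2 := by unfold stepVariance; gcongr
    _ = _ := by rw [← inv_pow, one_div]; ring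

/-- The Lipschitz bound on `g (1 - g)` passes under the integral. It pays for replacing the current
parameter `β_N` by the frozen `β_n`. -/
theorem abs_stepVariance_sub_le (hR : ∀ᵐ x ∂PX, ‖x‖ ≤ R) (t b c : Vec d) :
    |stepVariance PX t b - stepVariance PX t c| ≤
      (1 / Real.log 2 * R * ‖t‖) ^ 2 * R * ‖b - c‖ := by
  have h : |∫ x, (inner ℝ x t ^ 2 * (logistic x b * (1 - logistic x b)) -
      inner ℝ x t ^ 2 * (logistic x c * (1 - logistic x c))) ∂PX| ≤
      (R * ‖t‖) ^ 2 * R * ‖b - c‖ := by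
    have := norm_integral_le_of_norm_le_const (μ := PX) (C := (R * ‖t‖) ^ 2 * R * ‖b - c‖)
      (f := fun x => inner ℝ x t ^ 2 * (logistic x b * (1 - logistic x b)) -
        inner ℝ x t ^ 2 * (logistic x c * (1 - logistic x c))) ?_
    · simpa using this
    · filter_upwards [hR] with x hx
      rw [← mul_sub, norm_mul, Real.norm_of_nonneg (sq_nonneg _), mul_assoc]
      exact mul_le_mul (inner_sq_le hx t) ((abs_logistic_variance_sub_le x b c).trans (by gcongr))
        (norm_nonneg _) (sq_nonneg _)
  rw [stepVariance, stepVariance, ← mul_sub,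
    ← integral_sub (integrable_stepVariance hR t b) (integrable_stepVariance hR t c), abs_mul,
    abs_of_nonneg (by positivity)]
  calc _ ≤ (Real.log 2 ^ 2)⁻¹ * ((R * ‖t‖) ^ 2 * R * ‖b - c‖) := by gcongr
    _ = _ := by rw [← inv_pow, one_div]; ring

theorem continuous_stepVariance (hR0 : 0 ≤ R) (hR : ∀ᵐ x ∂PX, ‖x‖ ≤ R) (t : Vec d) :
    Continuous (stepVariance PX t) := by
  refine (LipschitzWith.of_dist_le_mul (K := ⟨(1 / Real.log 2 * R * ‖t‖) ^ 2 * R, by positivity⟩)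
    fun b c => ?_).continuous
  rw [Real.dist_eq, dist_eq_norm]
  exact abs_stepVariance_sub_le hR t b c

theorem dotProduct_asympCov_mulVec (hR : ∀ᵐ x ∂PX, ‖x‖ ≤ R) (t b : Vec d) :
    (t : Fin d → ℝ) ⬝ᵥ (asympCov PX b).mulVec t = stepVariance PX t b := by
  have hint (i j : Fin d) : Integrable
      (fun x : Vec d => x i * x j * (logistic x b * (1 - logistic x b))) PX := by
    refine Integrable.of_bound (by fun_prop) (R * R) ?_
    filter_upwards [hR] with x hx
    have h1 (i : Fin d) : ‖x i‖ ≤ R := (PiLp.norm_apply_le x i).trans hx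
    rw [norm_mul, norm_mul, Real.norm_of_nonneg (logistic_variance_nonneg x b)]
    refine (mul_le_of_le_one_right (by positivity) (logistic_variance_le_one x b)).trans ?_
    exact mul_le_mul (h1 i) (h1 j) (norm_nonneg _) ((norm_nonneg _).trans (h1 i))
  have h (x : Vec d) : inner ℝ x t ^ 2 * (logistic x b * (1 - logistic x b)) =
      ∑ i, ∑ j, t i * t j * (x i * x j * (logistic x b * (1 - logistic x b))) := by
    rw [PiLp.inner_apply, sq, Finset.sum_mul_sum, Finset.sum_mul]
    refine Finset.sum_congr rfl fun i _ => ?_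
    rw [Finset.sum_mul]
    refine Finset.sum_congr rfl fun j _ => ?_
    simp only [RCLike.inner_apply, conj_trivial]
    ring
  simp_rw [stepVariance, h]
  rw [integral_finsetSum _ fun i _ => integrable_finsetSum _ fun j _ => (hint i j).const_mul _,
    Finset.mul_sum]
  refine Finset.sum_congr rfl fun i _ => ?_
  rw [integral_finsetSum _ fun j _ => (hint i j).const_mul _, Matrix.mulVec, dotProduct,
    Finset.mul_sum, Finset.mul_sum]
  refine Finset.sum_congr rfl fun j _ => ?_
  rw [integral_const_mul, asympCov, Matrix.of_apply]
  ring

theorem posSemidef_asympCov (hR : ∀ᵐ x ∂PX, ‖x‖ ≤ R) (b : Vec d) :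
    (asympCov PX b).PosSemidef := by
  refine Matrix.PosSemidef.of_dotProduct_mulVec_nonneg ?_ fun t => ?_
  · ext i j
    simp [asympCov, mul_comm]
  · have := dotProduct_asympCov_mulVec hR (WithLp.toLp 2 t) b
    simp only [star_trivial] at this ⊢
    rw [this]
    exact stepVariance_nonneg _ _

theorem continuous_stepVariance_left (hR : ∀ᵐ x ∂PX, ‖x‖ ≤ R) (b : Vec d) :
    Continuous fun t => stepVariance PX t b := by
  simp_rw [← dotProduct_asympCov_mulVec hR]
  fun_prop

/-- Expand the exponential to second order: the linear term integrates to zero, the quadratic one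
gives the variance, and the remainder is cubic because the increment is bounded. -/
theorem norm_integral_exp_increment_sub_le (hR : ∀ᵐ x ∂PX, ‖x‖ ≤ R) (t b : Vec d) {s : ℝ}
    (hs : 0 ≤ s) :
    ‖∫ z, Complex.exp ((s * inner ℝ (increment b z) t : ℝ) * Complex.I) ∂predictiveLaw PX b -
      ((1 - s ^ 2 * stepVariance PX t b / 2 : ℝ) : ℂ)‖ ≤
      4 * (s * (1 / Real.log 2 * R * ‖t‖)) ^ 3 := by
  set u : Vec d × Fin 2 → ℝ := fun z => s * inner ℝ (increment b z) t with hu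
  have hum : Measurable u := by fun_prop
  have hub : ∀ᵐ z ∂predictiveLaw PX b, |u z| ≤ s * (1 / Real.log 2 * R * ‖t‖) := by
    filter_upwards [ae_norm_increment_le hR b b] with z hz
    rw [hu, abs_mul, abs_of_nonneg hs]
    gcongr
    exact abs_inner_increment_le hz
  have hu1 : Integrable u (predictiveLaw PX b) := Integrable.of_bound (by fun_prop) _ hub
  have hu2 : Integrable (fun z => u z ^ 2) (predictiveLaw PX b) := by
    refine Integrable.of_bound (by fun_prop) ((s * (1 / Real.log 2 * R * ‖t‖)) ^ 2) ?_
    filter_upwards [hub] with z hz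
    rw [norm_pow]
    exact pow_le_pow_left₀ (norm_nonneg _) hz 2
  have hu1c : Integrable (fun z => (u z : ℂ) * Complex.I) (predictiveLaw PX b) :=
    hu1.ofReal.mul_const _
  have hu2c : Integrable (fun z => (u z : ℂ) ^ 2 / 2) (predictiveLaw PX b) := by
    have := hu2.ofReal (𝕜 := ℂ)
    push_cast at this
    exact this.div_const _
  have hexp : Integrable (fun z => Complex.exp (u z * Complex.I)) (predictiveLaw PX b) :=
    Integrable.of_bound (by fun_prop) 1
      (ae_of_all _ fun z => (Complex.norm_exp_ofReal_mul_I _).le)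
  have hadd : Integrable (fun z => (1 + u z * Complex.I : ℂ)) (predictiveLaw PX b) :=
    (integrable_const _).add hu1c
  have hq : Integrable (fun z => (1 + u z * Complex.I - u z ^ 2 / 2 : ℂ)) (predictiveLaw PX b) :=
    hadd.sub hu2c
  have e : ((1 - s ^ 2 * stepVariance PX t b / 2 : ℝ) : ℂ) =
      ∫ z, (1 + u z * Complex.I - u z ^ 2 / 2 : ℂ) ∂predictiveLaw PX b := by
    have e1 : ∫ z, (u z : ℂ) * Complex.I ∂predictiveLaw PX b = 0 := by
      rw [integral_mul_const, integral_complex_ofReal, hu, integral_const_mul,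
        integral_inner_increment hR]
      simp
    have e2 : ∫ z, (u z : ℂ) ^ 2 / 2 ∂predictiveLaw PX b =
        ((s ^ 2 * stepVariance PX t b / 2 : ℝ) : ℂ) := by
      rw [integral_div]
      simp_rw [← Complex.ofReal_pow]
      rw [integral_complex_ofReal]
      simp_rw [hu, mul_pow]
      rw [integral_const_mul, integral_inner_increment_sq hR]
      push_cast
      ring
    rw [integral_sub hadd hu2c, integral_add (integrable_const _) hu1c,
      e1, e2]
    simp
  rw [e, ← integral_sub hexp hq]
  refine (norm_integral_le_of_norm_le_const (C := 4 * (s * (1 / Real.log 2 * R * ‖t‖)) ^ 3) ?_).trans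
    (by simp)
  filter_upwards [hub] with z hz
  refine (norm_exp_mul_I_sub_quadratic_le _).trans ?_
  gcongr

/-- With `s = √n / (N + 1)` and `τ = n / N - n / (N + 1) = n / (N (N + 1))`, the errors `s ^ 3`, `τ
- s ^ 2` and `τ ^ 2` are all at most `τ / √n` because `n ≤ N`. Keeping the factor `τ` is what makes
the errors summable over `N` later. -/
theorem norm_integral_exp_increment_sub_exp_le (hR0 : 0 ≤ R) (hR : ∀ᵐ x ∂PX, ‖x‖ ≤ R)
    (t b c : Vec d) {n N : ℕ} (hn : 1 ≤ n) (hN : n ≤ N) {T : ℝ}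
    (hT : T = 1 / Real.log 2 * R * ‖t‖) :
    ‖∫ z, Complex.exp ((√n / (N + 1) * inner ℝ (increment b z) t : ℝ) * Complex.I)
        ∂predictiveLaw PX b -
      (Real.exp (-(stepVariance PX t c * ((n / N - n / (N + 1)) / 2))) : ℂ)‖ ≤
      (n / N - n / (N + 1)) * ((4 * T ^ 3 + T ^ 2 + T ^ 4) / √n + T ^ 2 * R * ‖b - c‖) := by
  have hlog : 0 < Real.log 2 := Real.log_pos (by norm_num)
  have hT0 : 0 ≤ T := by rw [hT]; positivity
  have h1 := norm_integral_exp_increment_sub_le hR t b (s := √n / (N + 1)) (by positivity)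
  have h2 := abs_stepVariance_sub_le hR t b c
  have h3 := stepVariance_le hR t c
  have h4 := stepVariance_nonneg (PX := PX) t c
  rw [← hT] at h1 h2 h3
  set v := stepVariance PX t b
  set w := stepVariance PX t c
  set m : ℝ := √n with hm
  set D := ‖b - c‖
  have hD : 0 ≤ D := norm_nonneg _
  have hm1 : 1 ≤ m := by rw [hm, Real.one_le_sqrt]; exact_mod_cast hn
  have hnm : (n : ℝ) = m ^ 2 := (Real.sq_sqrt (by positivity)).symm
  have hNm : m ^ 2 ≤ N := by rw [← hnm]; exact_mod_cast hN
  rw [hnm]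
  set M : ℝ := (N : ℝ)
  have hM : 1 ≤ M := by nlinarith
  have hM0 : 0 < M := by linarith
  have hm0 : 0 < m := by linarith
  have hmM : m ≤ M := by nlinarith
  have hτ : m ^ 2 / M - m ^ 2 / (M + 1) = m ^ 2 / (M * (M + 1)) := by field_simp; ring
  rw [hτ]
  set τ := m ^ 2 / (M * (M + 1)) with hτd
  have hτ0 : 0 ≤ τ := by positivity
  set s := m / (M + 1) with hs
  have hs0 : 0 ≤ s := by positivity
  have hsτ : s ^ 2 ≤ τ := by
    rw [hs, hτd, div_pow]
    gcongr
    nlinarith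
  have hs3 : s ^ 3 ≤ τ / m := by
    rw [hs, hτd, div_pow, div_div, div_le_div_iff₀ (by positivity) (by positivity)]
    have : m ^ 2 * M ≤ (M + 1) ^ 2 := by nlinarith
    calc m ^ 3 * (M * (M + 1) * m) = (m ^ 2 * M) * (m ^ 2 * (M + 1)) := by ring
      _ ≤ (M + 1) ^ 2 * (m ^ 2 * (M + 1)) := by gcongr
      _ = _ := by ring
  have hτs : τ - s ^ 2 ≤ τ / m := by
    have : τ - s ^ 2 = τ / (M + 1) := by rw [hτd, hs]; field_simp; ring
    rw [this]
    gcongr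
    linarith
  have hττ : τ ^ 2 ≤ τ / m := by
    have : τ ≤ 1 / m := by
      rw [hτd, div_le_div_iff₀ (by positivity) hm0]
      nlinarith
    calc τ ^ 2 = τ * τ := sq τ
      _ ≤ τ * (1 / m) := by gcongr
      _ = _ := by ring
  have h5 := abs_one_sub_sub_exp_neg_le (x := w * (τ / 2)) (by positivity)
  have hb : |(1 - s ^ 2 * v / 2) - Real.exp (-(w * (τ / 2)))| ≤
      τ * (T ^ 2 * R * D) + T ^ 2 * (τ / m) + T ^ 4 * (τ / m) := by
    -- Three separate errors: moving the parameter from `b` to `c`, replacing `s ^ 2` by `τ`, and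
    -- linearising the exponential.
    have e : (1 - s ^ 2 * v / 2) - Real.exp (-(w * (τ / 2))) =
        -(s ^ 2 / 2 * (v - w)) + w / 2 * (τ - s ^ 2) +
          (1 - w * (τ / 2) - Real.exp (-(w * (τ / 2)))) := by ring
    rw [e]
    refine (abs_add_three _ _ _).trans ?_
    gcongr
    · rw [abs_neg, abs_mul, abs_of_nonneg (by positivity)]
      gcongr
      linarith
    · rw [abs_mul, abs_of_nonneg (by positivity), abs_of_nonneg (by linarith)]
      gcongr
      linarith
    · refine h5.trans ?_
      calc (w * (τ / 2)) ^ 2 ≤ (T ^ 2 * τ) ^ 2 := by gcongr; linarith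
        _ = T ^ 4 * τ ^ 2 := by ring
        _ ≤ _ := by gcongr
  calc _ ≤ _ + ‖((1 - s ^ 2 * v / 2 : ℝ) : ℂ) - (Real.exp (-(w * (τ / 2))) : ℂ)‖ :=
        norm_sub_le_norm_sub_add_norm_sub _ ((1 - s ^ 2 * v / 2 : ℝ) : ℂ) _
    _ ≤ 4 * (s * T) ^ 3 + (τ * (T ^ 2 * R * D) + T ^ 2 * (τ / m) + T ^ 4 * (τ / m)) := by
        refine add_le_add h1 ?_
        rw [← Complex.ofReal_sub, Complex.norm_real]
        exact hb
    _ = 4 * T ^ 3 * s ^ 3 + (τ * (T ^ 2 * R * D) + T ^ 2 * (τ / m) + T ^ 4 * (τ / m)) := by ring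
    _ ≤ 4 * T ^ 3 * (τ / m) + (τ * (T ^ 2 * R * D) + T ^ 2 * (τ / m) + T ^ 4 * (τ / m)) := by
        gcongr
    _ = _ := by ring

end StepVariance

end OnlineGradient

/-- Disintegration of an expectation along a regular conditional distribution. -/
theorem integral_eq_integral_integral_condDistrib {α β Ω' F : Type*} {mα : MeasurableSpace α}
    {mβ : MeasurableSpace β} {μ : Measure α} [IsFiniteMeasure μ] [MeasurableSpace Ω']
    [StandardBorelSpace Ω'] [Nonempty Ω'] [NormedAddCommGroup F] [NormedSpace ℝ F]
    [CompleteSpace F] {X : α → β} {Y : α → Ω'} (hX : Measurable X) (hY : AEMeasurable Y μ)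
    {f : β × Ω' → F} (hf : StronglyMeasurable f) (hf_int : Integrable (fun a => f (X a, Y a)) μ) :
    ∫ a, f (X a, Y a) ∂μ = ∫ a, ∫ y, f (X a, y) ∂condDistrib Y X μ (X a) ∂μ := by
  rw [← integral_congr_ae (condExp_prod_ae_eq_integral_condDistrib hX hY hf hf_int),
    integral_condExp hX.comap_le]

namespace OnlineGradient

/-! ### The data filtration and conditioning on the past -/

section Observations

variable {d : ℕ} {Ω : Type*} [MeasurableSpace Ω] {P : Measure Ω} [IsProbabilityMeasure P]
  {PX : Measure (Vec d)} [IsProbabilityMeasure PX]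
  {β₀ : Ω → Vec d} {X : ℕ → Ω → Vec d} {Y : ℕ → Ω → Fin 2}

theorem measurable_history (hβ₀ : Measurable β₀) (hX : ∀ n, Measurable (X (n + 1)))
    (hY : ∀ n, Measurable (Y (n + 1))) (n : ℕ) : Measurable (history β₀ X Y n) :=
  hβ₀.prodMk (measurable_pi_lambda _ fun i => (hX i).prodMk (hY i))

/-- The filtration generated by the data. -/
def dataFiltration (hβ₀ : Measurable β₀) (hX : ∀ n, Measurable (X (n + 1)))
    (hY : ∀ n, Measurable (Y (n + 1))) : Filtration ℕ (inferInstance : MeasurableSpace Ω) where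
  seq n := MeasurableSpace.comap (history β₀ X Y n) inferInstance
  mono' n m hnm := by
    have h : history β₀ X Y n = (fun h => (h.1, fun i : Fin n => h.2 (Fin.castLE hnm i))) ∘
        history β₀ X Y m := rfl
    dsimp only
    rw [h, ← MeasurableSpace.comap_comp]
    refine MeasurableSpace.comap_mono (Measurable.comap_le ?_)
    exact measurable_fst.prodMk
      (measurable_pi_lambda _ fun i => (measurable_pi_apply _).comp measurable_snd)
  le' n := (measurable_history hβ₀ hX hY n).comap_le

variable (hβ₀ : Measurable β₀) (hX : ∀ n, Measurable (X (n + 1)))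
  (hY : ∀ n, Measurable (Y (n + 1)))

theorem measurable_history_dataFiltration (n : ℕ) :
    Measurable[dataFiltration hβ₀ hX hY n] (history β₀ X Y n) :=
  comap_measurable _

theorem measurable_datum_dataFiltration (n : ℕ) :
    Measurable[dataFiltration hβ₀ hX hY (n + 1)] fun ω => (X (n + 1) ω, Y (n + 1) ω) := by
  have : (fun ω => (X (n + 1) ω, Y (n + 1) ω)) =
      (fun h => h.2 (Fin.last n)) ∘ history β₀ X Y (n + 1) := rfl
  rw [this]
  exact ((measurable_pi_apply _).comp measurable_snd).comp
    (measurable_history_dataFiltration hβ₀ hX hY (n + 1))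

theorem measurable_iterate_dataFiltration (n : ℕ) :
    Measurable[dataFiltration hβ₀ hX hY n] (iterate β₀ X Y n) := by
  induction n with
  | zero => exact measurable_fst.comp (measurable_history_dataFiltration hβ₀ hX hY 0)
  | succ n ih =>
    have h1 := ih.mono ((dataFiltration hβ₀ hX hY).mono n.le_succ) le_rfl
    have h2 := measurable_datum_dataFiltration hβ₀ hX hY n
    have h3 := measurable_increment h1 h2
    have h4 : iterate β₀ X Y (n + 1) = fun ω => iterate β₀ X Y n ω +
      (1 / ((n : ℝ) + 1)) • increment (iterate β₀ X Y n ω) (X (n + 1) ω, Y (n + 1) ω) :=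
      funext fun ω => iterate_succ β₀ X Y n ω
    rw [h4]
    exact h1.add (h3.const_smul (1 / ((n : ℝ) + 1)))

include hβ₀ hX hY in
theorem measurable_iterate (n : ℕ) : Measurable (iterate β₀ X Y n) :=
  (measurable_iterate_dataFiltration hβ₀ hX hY n).mono ((dataFiltration hβ₀ hX hY).le n) le_rfl

omit [IsProbabilityMeasure PX] in
-- Freezing: any quantity `A` known at time `n` is held fixed while the next datum is integrated out
-- under the predictive law.
theorem condExp_datum_ae_eq (hrule : FollowsPredictiveRule P PX β₀ X Y) {n : ℕ}
    {α : Type*} [Nonempty α] [MeasurableSpace α] [StandardBorelSpace α] {A : Ω → α}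
    (hA : Measurable[dataFiltration hβ₀ hX hY n] A) {E : Type*} [NormedAddCommGroup E]
    [NormedSpace ℝ E] [CompleteSpace E] {F : α × Vec d × Fin 2 → E} (hF : StronglyMeasurable F)
    (hint : Integrable (fun ω => F (A ω, X (n + 1) ω, Y (n + 1) ω)) P) :
    P[fun ω => F (A ω, X (n + 1) ω, Y (n + 1) ω) | dataFiltration hβ₀ hX hY n] =ᵐ[P]
      fun ω => ∫ z, F (A ω, z) ∂predictiveLaw PX (iterate β₀ X Y n ω) := by
  -- Doob–Dynkin: `A` is a measurable function of the history, the variable on which `condDistrib`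
  -- conditions.
  obtain ⟨a, ha, rfl⟩ := hA.exists_eq_measurable_comp
  have hF' : StronglyMeasurable fun p : (Vec d × (Fin n → Vec d × Fin 2)) × Vec d × Fin 2 =>
      F (a p.1, p.2) :=
    hF.comp_measurable ((ha.comp measurable_fst).prodMk measurable_snd)
  refine (condExp_prod_ae_eq_integral_condDistrib (measurable_history hβ₀ hX hY n)
    ((hX n).prodMk (hY n)).aemeasurable hF' hint).trans ?_
  filter_upwards [hrule n] with ω hω
  rw [hω]
  rfl

omit [IsProbabilityMeasure PX] in
theorem integral_datum_eq (hrule : FollowsPredictiveRule P PX β₀ X Y) {n : ℕ}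
    {α : Type*} [Nonempty α] [MeasurableSpace α] [StandardBorelSpace α] {A : Ω → α}
    (hA : Measurable[dataFiltration hβ₀ hX hY n] A) {E : Type*} [NormedAddCommGroup E]
    [NormedSpace ℝ E] [CompleteSpace E] {F : α × Vec d × Fin 2 → E} (hF : StronglyMeasurable F)
    (hint : Integrable (fun ω => F (A ω, X (n + 1) ω, Y (n + 1) ω)) P) :
    ∫ ω, F (A ω, X (n + 1) ω, Y (n + 1) ω) ∂P =
      ∫ ω, ∫ z, F (A ω, z) ∂predictiveLaw PX (iterate β₀ X Y n ω) ∂P := by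
  rw [← integral_congr_ae (condExp_datum_ae_eq hβ₀ hX hY hrule hA hF hint), integral_condExp]

omit [IsProbabilityMeasure PX] in
theorem integrable_integral_datum (hrule : FollowsPredictiveRule P PX β₀ X Y) {n : ℕ}
    {α : Type*} [Nonempty α] [MeasurableSpace α] [StandardBorelSpace α] {A : Ω → α}
    (hA : Measurable[dataFiltration hβ₀ hX hY n] A) {E : Type*} [NormedAddCommGroup E]
    [NormedSpace ℝ E] [CompleteSpace E] {F : α × Vec d × Fin 2 → E} (hF : StronglyMeasurable F)
    (hint : Integrable (fun ω => F (A ω, X (n + 1) ω, Y (n + 1) ω)) P) :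
    Integrable (fun ω => ∫ z, F (A ω, z) ∂predictiveLaw PX (iterate β₀ X Y n ω)) P :=
  integrable_condExp.congr (condExp_datum_ae_eq hβ₀ hX hY hrule hA hF hint)

omit [IsProbabilityMeasure PX] in
include hβ₀ hX hY in
-- The bound passes from `P_X` to the observations by integrating the indicator of its violation; no
-- past information is needed, hence the trivial `A`.
theorem ae_norm_datum_le (hrule : FollowsPredictiveRule P PX β₀ X Y) {R : ℝ}
    (hR : ∀ᵐ x ∂PX, ‖x‖ ≤ R) (n : ℕ) : ∀ᵐ ω ∂P, ‖X (n + 1) ω‖ ≤ R := by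
  have hs : MeasurableSet {x : Vec d | R < ‖x‖} := measurableSet_lt (by fun_prop) (by fun_prop)
  have hint : Integrable
      (fun ω => {x : Vec d | R < ‖x‖}.indicator (fun _ => (1 : ℝ)) (X (n + 1) ω)) P := by
    refine Integrable.of_bound ?_ 1 (ae_of_all _ fun ω => by
      rw [Set.indicator_apply]; split_ifs <;> simp)
    exact ((stronglyMeasurable_const.indicator hs).comp_measurable (hX n)).aestronglyMeasurable
  have h := integral_datum_eq hβ₀ hX hY hrule (n := n) (A := fun _ => ()) measurable_const
    (F := fun p => ({x : Vec d | R < ‖x‖}.indicator (fun _ => (1 : ℝ)) p.2.1))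
    ((stronglyMeasurable_const.indicator hs).comp_measurable (by fun_prop)) hint
  have h0 : ∫ ω, {x : Vec d | R < ‖x‖}.indicator (fun _ => (1 : ℝ)) (X (n + 1) ω) ∂P = 0 := by
    refine h.trans (integral_eq_zero_of_ae (ae_of_all _ fun ω => integral_eq_zero_of_ae ?_))
    filter_upwards [ae_predictiveLaw_of_ae PX hR (iterate β₀ X Y n ω)] with z hz
    simp [hz]
  rw [integral_eq_zero_iff_of_nonneg
    (fun ω => Set.indicator_nonneg (fun _ _ => zero_le_one) _) hint] at h0
  filter_upwards [h0] with ω hω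
  by_contra hlt
  simp [not_le.1 hlt] at hω

end Observations

/-! ### Conditional moments of the displacement of the iterates -/

section Moments

variable {d : ℕ} {Ω : Type*} [MeasurableSpace Ω] {P : Measure Ω} [IsProbabilityMeasure P]
  {PX : Measure (Vec d)} [IsProbabilityMeasure PX]
  {β₀ : Ω → Vec d} {X : ℕ → Ω → Vec d} {Y : ℕ → Ω → Fin 2} {R : ℝ}
  (hβ₀ : Measurable β₀) (hX : ∀ n, Measurable (X (n + 1)))
  (hY : ∀ n, Measurable (Y (n + 1))) (hrule : FollowsPredictiveRule P PX β₀ X Y)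
  (hR : ∀ᵐ x ∂PX, ‖x‖ ≤ R)

omit [IsProbabilityMeasure PX] in
include hβ₀ hX hY hrule hR in
theorem ae_norm_iterate_increment_le (n : ℕ) :
    ∀ᵐ ω ∂P, ‖increment (iterate β₀ X Y n ω) (X (n + 1) ω, Y (n + 1) ω)‖ ≤
      1 / Real.log 2 * R := by
  have hlog : 0 < Real.log 2 := Real.log_pos (by norm_num)
  filter_upwards [ae_norm_datum_le hβ₀ hX hY hrule hR n] with ω hω
  exact (norm_increment_le _ _).trans (by simp only; gcongr)

include hβ₀ hX hY in
theorem measurable_iterate_increment (n : ℕ) :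
    Measurable fun ω => increment (iterate β₀ X Y n ω) (X (n + 1) ω, Y (n + 1) ω) :=
  measurable_increment (measurable_iterate hβ₀ hX hY n) ((hX n).prodMk (hY n))

omit [IsProbabilityMeasure PX] in
include hβ₀ hX hY hrule hR in
-- A crude bound whose constant depends on `n` and `N`; it serves to justify integrability and never
-- enters a rate.
theorem exists_ae_norm_iterate_sub_le {n N : ℕ} (hN : n ≤ N) :
    ∃ C, 0 ≤ C ∧ ∀ᵐ ω ∂P, ‖iterate β₀ X Y N ω - iterate β₀ X Y n ω‖ ≤ C := by
  induction N, hN using Nat.le_induction with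
  | base => exact ⟨0, le_rfl, by simp⟩
  | succ N hN ih =>
    obtain ⟨C, hC, h⟩ := ih
    refine ⟨C + 1 / ((N : ℝ) + 1) * |1 / Real.log 2 * R|, by positivity, ?_⟩
    filter_upwards [h, ae_norm_iterate_increment_le hβ₀ hX hY hrule hR N] with ω h1 h2
    rw [iterate_succ, add_sub_right_comm]
    refine (norm_add_le _ _).trans (add_le_add h1 ?_)
    rw [norm_smul, Real.norm_of_nonneg (by positivity)]
    gcongr
    exact h2.trans (le_abs_self _)

theorem integral_inner_iterate_increment {n : ℕ} {u : Ω → Vec d}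
    (hu : Measurable[dataFiltration hβ₀ hX hY n] u) {C : ℝ} (huC : ∀ᵐ ω ∂P, ‖u ω‖ ≤ C)
    (hrule : FollowsPredictiveRule P PX β₀ X Y) (hR : ∀ᵐ x ∂PX, ‖x‖ ≤ R) :
    ∫ ω, inner ℝ (increment (iterate β₀ X Y n ω) (X (n + 1) ω, Y (n + 1) ω)) (u ω) ∂P = 0 := by
  have hA : Measurable[dataFiltration hβ₀ hX hY n] fun ω => (u ω, iterate β₀ X Y n ω) :=
    hu.prodMk (measurable_iterate_dataFiltration hβ₀ hX hY n)
  have hinc := measurable_iterate_increment hβ₀ hX hY n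
  have hu' : Measurable u := hu.mono ((dataFiltration hβ₀ hX hY).le n) le_rfl
  refine (integral_datum_eq hβ₀ hX hY hrule hA
    (F := fun p => inner ℝ (increment p.1.2 p.2) p.1.1)
    (by fun_prop : Measurable _).stronglyMeasurable ?_).trans ?_
  · refine Integrable.of_bound (by fun_prop) (1 / Real.log 2 * R * C) ?_
    filter_upwards [huC, ae_norm_iterate_increment_le hβ₀ hX hY hrule hR n] with ω h1 h2
    exact (norm_inner_le_norm _ _).trans
      (mul_le_mul h2 h1 (norm_nonneg _) ((norm_nonneg _).trans h2))
  · simp only [integral_inner_increment hR, integral_zero]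

/-- Orthogonality of martingale increments leaves the sum of the squared step bounds `ρ ^ 2 / (k +
1) ^ 2`, which is dominated by a telescoping sum. The weight `w` turns this into a conditional
statement given the data at time `n`. -/
theorem integral_mul_norm_iterate_sub_sq_le {n N : ℕ} (hn : 1 ≤ n) (hN : n ≤ N) {w : Ω → ℝ}
    (hw : Measurable[dataFiltration hβ₀ hX hY n] w) (hw0 : ∀ ω, 0 ≤ w ω) (hw1 : ∀ ω, w ω ≤ 1)
    (hrule : FollowsPredictiveRule P PX β₀ X Y) (hR : ∀ᵐ x ∂PX, ‖x‖ ≤ R) :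
    ∫ ω, w ω * ‖iterate β₀ X Y N ω - iterate β₀ X Y n ω‖ ^ 2 ∂P ≤
      (1 / Real.log 2 * R) ^ 2 * (1 / n - 1 / N) * ∫ ω, w ω ∂P := by
  have hw' : Measurable w := hw.mono ((dataFiltration hβ₀ hX hY).le n) le_rfl
  have hwint : Integrable w P := Integrable.of_bound (by fun_prop) 1
    (ae_of_all _ fun ω => by rw [Real.norm_of_nonneg (hw0 ω)]; exact hw1 ω)
  induction N, hN using Nat.le_induction with
  | base => simp
  | succ N hN ih =>
    have hN0 : (0 : ℝ) < N := by exact_mod_cast hn.trans hN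
    set ρ := 1 / Real.log 2 * R
    set B := fun k ω => iterate β₀ X Y k ω
    set ξ := fun ω => increment (iterate β₀ X Y N ω) (X (N + 1) ω, Y (N + 1) ω)
    have hB (k : ℕ) : Measurable (B k) := measurable_iterate hβ₀ hX hY k
    have hξ : Measurable ξ := measurable_iterate_increment hβ₀ hX hY N
    have hξb : ∀ᵐ ω ∂P, ‖ξ ω‖ ≤ ρ := ae_norm_iterate_increment_le hβ₀ hX hY hrule hR N
    obtain ⟨C, hC0, hC⟩ := exists_ae_norm_iterate_sub_le hβ₀ hX hY hrule hR hN
    have hub : ∀ᵐ ω ∂P, ‖w ω • (B N ω - B n ω)‖ ≤ C := by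
      filter_upwards [hC] with ω h
      rw [norm_smul, Real.norm_of_nonneg (hw0 ω)]
      exact (mul_le_of_le_one_left (norm_nonneg _) (hw1 ω)).trans h
    have hu : Measurable[dataFiltration hβ₀ hX hY N] fun ω => w ω • (B N ω - B n ω) := by
      have h1 := (dataFiltration hβ₀ hX hY).mono hN
      exact (hw.mono h1 le_rfl).smul ((measurable_iterate_dataFiltration hβ₀ hX hY N).sub
        ((measurable_iterate_dataFiltration hβ₀ hX hY n).mono h1 le_rfl))
    -- The cross term vanishes because the weighted displacement is known at time `N` and a.s.
    -- bounded.
    have hcross := integral_inner_iterate_increment hβ₀ hX hY hu hub hrule hR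
    have i1 : Integrable (fun ω => w ω * ‖B N ω - B n ω‖ ^ 2) P := by
      refine Integrable.of_bound (by fun_prop) (C ^ 2) ?_
      filter_upwards [hC] with ω h
      rw [norm_mul, Real.norm_of_nonneg (hw0 ω), norm_pow, norm_norm]
      exact (mul_le_of_le_one_left (by positivity) (hw1 ω)).trans (by gcongr)
    have i2 : Integrable (fun ω => 2 / ((N : ℝ) + 1) * inner ℝ (ξ ω) (w ω • (B N ω - B n ω))) P := by
      refine Integrable.const_mul (Integrable.of_bound (by fun_prop) (ρ * C) ?_) _
      filter_upwards [hub, hξb] with ω h1 h2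
      exact (norm_inner_le_norm _ _).trans
        (mul_le_mul h2 h1 (norm_nonneg _) ((norm_nonneg _).trans h2))
    have i12 : Integrable (fun ω => w ω * ‖B N ω - B n ω‖ ^ 2 +
        2 / ((N : ℝ) + 1) * inner ℝ (ξ ω) (w ω • (B N ω - B n ω))) P := i1.add i2
    have i3 : Integrable (fun ω => (ρ / (N + 1)) ^ 2 * w ω) P := hwint.const_mul _
    have hle : ∫ ω, w ω * ‖B (N + 1) ω - B n ω‖ ^ 2 ∂P ≤
        ∫ ω, (w ω * ‖B N ω - B n ω‖ ^ 2 +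
          2 / ((N : ℝ) + 1) * inner ℝ (ξ ω) (w ω • (B N ω - B n ω)) +
          (ρ / (N + 1)) ^ 2 * w ω) ∂P := by
      refine integral_mono_of_nonneg
        (ae_of_all _ fun ω => mul_nonneg (hw0 ω) (sq_nonneg _)) (i12.add i3) ?_
      filter_upwards [hξb] with ω h
      have e : B (N + 1) ω - B n ω = (B N ω - B n ω) + (1 / ((N : ℝ) + 1)) • ξ ω := by
        simp only [B, iterate_succ]
        abel
      have h1 : ‖(1 / ((N : ℝ) + 1)) • ξ ω‖ ≤ ρ / (N + 1) := by
        rw [norm_smul, Real.norm_of_nonneg (by positivity), one_div_mul_eq_div]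
        gcongr
      rw [e, norm_add_sq_real, inner_smul_right, inner_smul_right,
        real_inner_comm (B N ω - B n ω) (ξ ω)]
      have h2 : ‖(1 / ((N : ℝ) + 1)) • ξ ω‖ ^ 2 ≤ (ρ / (N + 1)) ^ 2 := by gcongr
      have h3 := mul_le_mul_of_nonneg_left h2 (hw0 ω)
      refine le_of_eq_of_le ?_ (add_le_add_right (h3.trans_eq (mul_comm _ _)) _)
      ring
    rw [integral_add i12 i3, integral_add i1 i2, integral_const_mul, hcross, mul_zero,
      add_zero, integral_const_mul] at hle
    have hI : 0 ≤ ∫ ω, w ω ∂P := integral_nonneg hw0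
    have hk : (ρ / ((N : ℝ) + 1)) ^ 2 ≤ ρ ^ 2 * (1 / N - 1 / (N + 1)) := by
      have : 1 / (N : ℝ) - 1 / (N + 1) = 1 / (N * (N + 1)) := by field_simp; ring
      rw [this, div_pow, div_eq_mul_one_div]
      gcongr
      nlinarith
    calc _ ≤ _ := hle
      _ ≤ ρ ^ 2 * (1 / n - 1 / N) * ∫ ω, w ω ∂P + ρ ^ 2 * (1 / N - 1 / (N + 1)) * ∫ ω, w ω ∂P := by
          gcongr
      _ = _ := by push_cast; ring

/-- The rate constant in the conditional characteristic function estimate. -/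
def rateConst (R : ℝ) (t : Vec d) : ℝ :=
  4 * (1 / Real.log 2 * R * ‖t‖) ^ 3 + (1 / Real.log 2 * R * ‖t‖) ^ 2 +
    (1 / Real.log 2 * R * ‖t‖) ^ 4 +
    (1 / Real.log 2 * R * ‖t‖) ^ 2 * R * ((1 + (1 / Real.log 2 * R) ^ 2) / 2)

theorem integral_mul_norm_iterate_sub_le {n N : ℕ} (hn : 1 ≤ n) (hN : n ≤ N) {w : Ω → ℝ}
    (hw : Measurable[dataFiltration hβ₀ hX hY n] w) (hw0 : ∀ ω, 0 ≤ w ω) (hw1 : ∀ ω, w ω ≤ 1)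
    (hrule : FollowsPredictiveRule P PX β₀ X Y) (hR : ∀ᵐ x ∂PX, ‖x‖ ≤ R) :
    ∫ ω, w ω * ‖iterate β₀ X Y N ω - iterate β₀ X Y n ω‖ ∂P ≤
      (1 + (1 / Real.log 2 * R) ^ 2) / 2 / √n * ∫ ω, w ω ∂P := by
  have hw' : Measurable w := hw.mono ((dataFiltration hβ₀ hX hY).le n) le_rfl
  have hwint : Integrable w P := Integrable.of_bound (by fun_prop) 1
    (ae_of_all _ fun ω => by rw [Real.norm_of_nonneg (hw0 ω)]; exact hw1 ω)
  obtain ⟨C, hC0, hC⟩ := exists_ae_norm_iterate_sub_le hβ₀ hX hY hrule hR hN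
  have hB (k : ℕ) : Measurable (iterate β₀ X Y k) := measurable_iterate hβ₀ hX hY k
  have i1 : Integrable
      (fun ω => w ω * ‖iterate β₀ X Y N ω - iterate β₀ X Y n ω‖ ^ 2) P := by
    refine Integrable.of_bound (by fun_prop) (C ^ 2) ?_
    filter_upwards [hC] with ω h
    rw [norm_mul, Real.norm_of_nonneg (hw0 ω), norm_pow, norm_norm]
    exact (mul_le_of_le_one_left (by positivity) (hw1 ω)).trans (by gcongr)
  have h2 := integral_mul_norm_iterate_sub_sq_le hβ₀ hX hY hn hN hw hw0 hw1 hrule hR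
  have hI : 0 ≤ ∫ ω, w ω ∂P := integral_nonneg hw0
  have hn0 : (0 : ℝ) < n := by exact_mod_cast hn
  have hm0 : 0 < √(n : ℝ) := Real.sqrt_pos.2 hn0
  have hmn : (n : ℝ) = √n ^ 2 := (Real.sq_sqrt hn0.le).symm
  calc _ ≤ ∫ ω, (1 / 2 / √n * w ω +
          √n / 2 * (w ω * ‖iterate β₀ X Y N ω - iterate β₀ X Y n ω‖ ^ 2)) ∂P := by
        refine integral_mono_of_nonneg (ae_of_all _ fun ω => mul_nonneg (hw0 ω) (norm_nonneg _))
          ((hwint.const_mul _).add (i1.const_mul _)) (ae_of_all _ fun ω => ?_)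
        dsimp only
        set D := ‖iterate β₀ X Y N ω - iterate β₀ X Y n ω‖
        -- AM–GM scaled by `√n`, which balances the constant term against a second moment of order
        -- `1 / n`.
        have : D ≤ 1 / 2 / √n + √n / 2 * D ^ 2 := by
          rw [← sub_nonneg]
          have : 1 / 2 / √n + √n / 2 * D ^ 2 - D = (√n * D - 1) ^ 2 / (2 * √n) := by
            field_simp; ring
          rw [this]; positivity
        nlinarith [mul_le_mul_of_nonneg_left this (hw0 ω)]
    _ = 1 / 2 / √n * ∫ ω, w ω ∂P +
          √n / 2 * ∫ ω, w ω * ‖iterate β₀ X Y N ω - iterate β₀ X Y n ω‖ ^ 2 ∂P := by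
        rw [integral_add (hwint.const_mul _) (i1.const_mul _), integral_const_mul,
          integral_const_mul]
    _ ≤ 1 / 2 / √n * ∫ ω, w ω ∂P +
          √n / 2 * ((1 / Real.log 2 * R) ^ 2 * (1 / n) * ∫ ω, w ω ∂P) := by
        gcongr
        refine h2.trans ?_
        gcongr
        have : (0 : ℝ) ≤ 1 / N := by positivity
        linarith
    _ = _ := by
        nth_rw 3 [hmn]
        field_simp

end Moments

/-! ### Interpolation between the Gaussian factor and the limiting phase -/

section CharFun

variable {d : ℕ} {Ω : Type*} [MeasurableSpace Ω] {P : Measure Ω} [IsProbabilityMeasure P]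
  {PX : Measure (Vec d)} [IsProbabilityMeasure PX]
  {β₀ : Ω → Vec d} {X : ℕ → Ω → Vec d} {Y : ℕ → Ω → Fin 2} {R : ℝ}
  (hβ₀ : Measurable β₀) (hX : ∀ n, Measurable (X (n + 1)))
  (hY : ∀ n, Measurable (Y (n + 1)))

/-- The phase `exp(i √n ⟨β_N - β_n, t⟩)` damped by `exp(-v_t(β_n) n / (2 N))`; it interpolates
between `exp(-v_t(β_n) / 2)` at `N = n` and the phase itself as `N → ∞`. -/
def dampedPhase (PX : Measure (Vec d)) (β₀ : Ω → Vec d) (X : ℕ → Ω → Vec d) (Y : ℕ → Ω → Fin 2)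
    (t : Vec d) (n N : ℕ) (ω : Ω) : ℂ :=
  Complex.exp ((√n * inner ℝ (iterate β₀ X Y N ω - iterate β₀ X Y n ω) t : ℝ) * Complex.I) *
    (Real.exp (-(stepVariance PX t (iterate β₀ X Y n ω) * (n / N / 2))) : ℂ)

omit [MeasurableSpace Ω] [IsProbabilityMeasure PX] in
theorem norm_dampedPhase_le (t : Vec d) (n N : ℕ) (ω : Ω) :
    ‖dampedPhase PX β₀ X Y t n N ω‖ ≤ 1 := by
  rw [dampedPhase, norm_mul, Complex.norm_exp_ofReal_mul_I, one_mul, Complex.norm_real,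
    Real.norm_eq_abs, Real.abs_exp, Real.exp_le_one_iff, neg_nonpos]
  exact mul_nonneg (stepVariance_nonneg _ _) (by positivity)

include hβ₀ hX hY in
theorem measurable_dampedPhase (hR0 : 0 ≤ R) (hR : ∀ᵐ x ∂PX, ‖x‖ ≤ R) (t : Vec d) (n N : ℕ) :
    Measurable (dampedPhase PX β₀ X Y t n N) := by
  have hB (k : ℕ) : Measurable (iterate β₀ X Y k) := measurable_iterate hβ₀ hX hY k
  have hv := (continuous_stepVariance hR0 hR t).measurable
  unfold dampedPhase
  fun_prop

/-- Both integrands share a factor `K` known at time `N`. What remains is the one-step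
characteristic function at `β_N` on one side and the ratio of dampings at `β_n` on the other. Their
distance involves `‖β_N - β_n‖`, whose weighted mean is `O(1 / √n)`; this produces the last summand
of `rateConst`. -/
theorem norm_integral_dampedPhase_succ_sub_le {n N : ℕ} (hn : 1 ≤ n) (hN : n ≤ N) {w : Ω → ℂ}
    (hw : Measurable[dataFiltration hβ₀ hX hY n] w) (hw1 : ∀ ω, ‖w ω‖ ≤ 1)
    (hrule : FollowsPredictiveRule P PX β₀ X Y) (hR0 : 0 ≤ R) (hR : ∀ᵐ x ∂PX, ‖x‖ ≤ R)
    (t : Vec d) :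
    ‖∫ ω, w ω * dampedPhase PX β₀ X Y t n (N + 1) ω ∂P -
      ∫ ω, w ω * dampedPhase PX β₀ X Y t n N ω ∂P‖ ≤
      rateConst R t / √n * ((n / N - n / (N + 1)) * ∫ ω, ‖w ω‖ ∂P) := by
  have hlog : 0 < Real.log 2 := Real.log_pos (by norm_num)
  have hw' : Measurable w := hw.mono ((dataFiltration hβ₀ hX hY).le n) le_rfl
  have hwint : Integrable w P := Integrable.of_bound (by fun_prop) 1 (ae_of_all _ hw1)
  have hB (k : ℕ) : Measurable (iterate β₀ X Y k) := measurable_iterate hβ₀ hX hY k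
  have hv := (continuous_stepVariance hR0 hR t).measurable
  have hUint (k : ℕ) : Integrable (fun ω => w ω * dampedPhase PX β₀ X Y t n k ω) P :=
    Integrable.of_bound
      (hw'.mul (measurable_dampedPhase hβ₀ hX hY hR0 hR t n k)).aestronglyMeasurable 1
      (ae_of_all _ fun ω => by
        rw [norm_mul]
        exact mul_le_one₀ (hw1 ω) (norm_nonneg _) (norm_dampedPhase_le t n k ω))
  set m : ℝ := √n with hm
  set τ : ℝ := (n : ℝ) / N - n / (N + 1) with hτ
  have hN0 : (0 : ℝ) < N := by exact_mod_cast hn.trans hN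
  have hτ0 : 0 ≤ τ := by
    rw [hτ, sub_nonneg]
    gcongr
    linarith
  -- the common factor of the two damped phases
  let K : ℂ × Vec d × Vec d → ℂ := fun a =>
    a.1 * (Complex.exp ((m * inner ℝ (a.2.2 - a.2.1) t : ℝ) * Complex.I) *
      (Real.exp (-(stepVariance PX t a.2.1 * (n / (N + 1) / 2))) : ℂ))
  have hKm : Measurable K := by fun_prop
  let A : Ω → ℂ × Vec d × Vec d := fun ω => (w ω, iterate β₀ X Y n ω, iterate β₀ X Y N ω)
  have hA : Measurable[dataFiltration hβ₀ hX hY N] A := by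
    have h1 := (dataFiltration hβ₀ hX hY).mono hN
    exact (hw.mono h1 le_rfl).prodMk
      (((measurable_iterate_dataFiltration hβ₀ hX hY n).mono h1 le_rfl).prodMk
        (measurable_iterate_dataFiltration hβ₀ hX hY N))
  have hA' : Measurable A := hA.mono ((dataFiltration hβ₀ hX hY).le N) le_rfl
  have hKA (ω : Ω) : ‖K (A ω)‖ ≤ ‖w ω‖ := by
    simp only [K, A]
    rw [norm_mul, norm_mul, Complex.norm_exp_ofReal_mul_I, one_mul, Complex.norm_real,
      Real.norm_eq_abs, Real.abs_exp]
    refine mul_le_of_le_one_right (norm_nonneg _) ?_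
    rw [Real.exp_le_one_iff, neg_nonpos]
    exact mul_nonneg (stepVariance_nonneg _ _) (by positivity)
  let ψ : Vec d → ℂ := fun b =>
    ∫ z, Complex.exp ((m / (N + 1) * inner ℝ (increment b z) t : ℝ) * Complex.I)
      ∂predictiveLaw PX b
  let e : Vec d → ℂ := fun c => (Real.exp (-(stepVariance PX t c * (τ / 2))) : ℂ)
  -- `K` already carries the damping of time `N + 1`, so moving on to `N + 1` only adds the phase of
  -- the new increment.
  have hnext (ω : Ω) : w ω * dampedPhase PX β₀ X Y t n (N + 1) ω =
      K (A ω) * Complex.exp ((m / (N + 1) *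
        inner ℝ (increment (A ω).2.2 (X (N + 1) ω, Y (N + 1) ω)) t : ℝ) * Complex.I) := by
    simp only [dampedPhase, K, A, iterate_succ, ← hm]
    rw [add_sub_right_comm, inner_add_left, inner_smul_left]
    push_cast
    rw [mul_add, add_mul, Complex.exp_add]
    simp only [conj_trivial]
    push_cast
    ring_nf
  have hcur (ω : Ω) : w ω * dampedPhase PX β₀ X Y t n N ω =
      K (A ω) * e (iterate β₀ X Y n ω) := by
    simp only [dampedPhase, K, A, e, ← hm]
    rw [mul_assoc, mul_assoc, ← Complex.ofReal_mul, ← Real.exp_add]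
    congr 5
    rw [hτ]
    ring
  have hFm : StronglyMeasurable fun p : (ℂ × Vec d × Vec d) × Vec d × Fin 2 => K p.1 *
      Complex.exp ((m / (N + 1) * inner ℝ (increment p.1.2.2 p.2) t : ℝ) * Complex.I) :=
    (by fun_prop : Measurable _).stronglyMeasurable
  have hint := hUint (N + 1)
  simp_rw [hnext] at hint
  have hψ (ω : Ω) : ∫ z, K (A ω) *
      Complex.exp ((m / (N + 1) * inner ℝ (increment (A ω).2.2 z) t : ℝ) * Complex.I)
        ∂predictiveLaw PX (iterate β₀ X Y N ω) = K (A ω) * ψ (iterate β₀ X Y N ω) :=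
    integral_const_mul _ _
  have hstep : ∫ ω, w ω * dampedPhase PX β₀ X Y t n (N + 1) ω ∂P =
      ∫ ω, K (A ω) * ψ (iterate β₀ X Y N ω) ∂P := by
    simp_rw [hnext, ← hψ]
    exact integral_datum_eq hβ₀ hX hY hrule hA hFm hint
  have i2 : Integrable (fun ω => K (A ω) * ψ (iterate β₀ X Y N ω)) P := by
    simp_rw [← hψ]
    exact integrable_integral_datum hβ₀ hX hY hrule hA hFm hint
  have hbound (b c : Vec d) := norm_integral_exp_increment_sub_exp_le hR0 hR t b c hn hN rfl
  set T := 1 / Real.log 2 * R * ‖t‖ with hT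
  have hT0 : 0 ≤ T := by positivity
  have hdiff (ω : Ω) : ‖K (A ω) * ψ (iterate β₀ X Y N ω) - K (A ω) * e (iterate β₀ X Y n ω)‖ ≤
      τ * ((4 * T ^ 3 + T ^ 2 + T ^ 4) / m) * ‖w ω‖ +
        τ * (T ^ 2 * R) * (‖w ω‖ * ‖iterate β₀ X Y N ω - iterate β₀ X Y n ω‖) := by
    rw [← mul_sub, norm_mul]
    refine (mul_le_mul (hKA ω) (hbound _ _) (norm_nonneg _) (norm_nonneg _)).trans_eq ?_
    ring
  have i1 : Integrable (fun ω => K (A ω) * e (iterate β₀ X Y n ω)) P := by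
    have := hUint N
    simp_rw [hcur] at this
    exact this
  obtain ⟨C, hC0, hC⟩ := exists_ae_norm_iterate_sub_le hβ₀ hX hY hrule hR hN
  have i3 : Integrable (fun ω => ‖w ω‖ * ‖iterate β₀ X Y N ω - iterate β₀ X Y n ω‖) P := by
    refine Integrable.of_bound (by fun_prop) C ?_
    filter_upwards [hC] with ω h
    rw [norm_mul, norm_norm, norm_norm]
    exact (mul_le_of_le_one_left (norm_nonneg _) (hw1 ω)).trans h
  have hmom := integral_mul_norm_iterate_sub_le hβ₀ hX hY hn hN (w := fun ω => ‖w ω‖)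
    (measurable_norm.comp hw)
    (fun ω => norm_nonneg _) hw1 hrule hR
  rw [← hm] at hmom
  rw [hstep]
  simp_rw [hcur]
  rw [← integral_sub i2 i1]
  have i4 : Integrable (fun ω => τ * ((4 * T ^ 3 + T ^ 2 + T ^ 4) / m) * ‖w ω‖ +
      τ * (T ^ 2 * R) * (‖w ω‖ * ‖iterate β₀ X Y N ω - iterate β₀ X Y n ω‖)) P :=
    (hwint.norm.const_mul _).add (i3.const_mul _)
  refine (norm_integral_le_of_norm_le i4 (ae_of_all _ hdiff)).trans ?_
  rw [integral_add (hwint.norm.const_mul _) (i3.const_mul _), integral_const_mul,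
    integral_const_mul]
  calc _ ≤ τ * ((4 * T ^ 3 + T ^ 2 + T ^ 4) / m) * ∫ ω, ‖w ω‖ ∂P +
        τ * (T ^ 2 * R) * ((1 + (1 / Real.log 2 * R) ^ 2) / 2 / m * ∫ ω, ‖w ω‖ ∂P) := by gcongr
    _ = _ := by rw [rateConst, ← hT]; ring

/-- The factors `n / k - n / (k + 1)` telescope to `1 - n / N`, so the bound does not deteriorate as
`N` grows. -/
theorem norm_integral_dampedPhase_sub_le {n N : ℕ} (hn : 1 ≤ n) (hN : n ≤ N) {w : Ω → ℂ}
    (hw : Measurable[dataFiltration hβ₀ hX hY n] w) (hw1 : ∀ ω, ‖w ω‖ ≤ 1)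
    (hrule : FollowsPredictiveRule P PX β₀ X Y) (hR0 : 0 ≤ R) (hR : ∀ᵐ x ∂PX, ‖x‖ ≤ R)
    (t : Vec d) :
    ‖∫ ω, w ω * dampedPhase PX β₀ X Y t n N ω ∂P -
      ∫ ω, w ω * dampedPhase PX β₀ X Y t n n ω ∂P‖ ≤
      rateConst R t / √n * ((1 - n / N) * ∫ ω, ‖w ω‖ ∂P) := by
  induction N, hN using Nat.le_induction with
  | base =>
    have : (n : ℝ) ≠ 0 := by positivity
    simp [this]
  | succ N hN ih =>
    have h := norm_integral_dampedPhase_succ_sub_le hβ₀ hX hY hn hN hw hw1 hrule hR0 hR t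
    refine (norm_sub_le_norm_sub_add_norm_sub _
      (∫ ω, w ω * dampedPhase PX β₀ X Y t n N ω ∂P) _).trans ((add_le_add h ih).trans_eq ?_)
    push_cast
    ring

theorem rateConst_nonneg (hR0 : 0 ≤ R) (t : Vec d) : 0 ≤ rateConst R t := by
  have hlog : 0 < Real.log 2 := Real.log_pos (by norm_num)
  unfold rateConst
  positivity

theorem continuous_rateConst : Continuous (rateConst (d := d) R) := by
  unfold rateConst
  fun_prop

/-- Let `N → ∞` by dominated convergence: the damping tends to `1` because `n / N → 0`, while at `N
= n` only the full Gaussian factor is present. -/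
theorem norm_integral_limit_phase_sub_le {n : ℕ} (hn : 1 ≤ n) {w : Ω → ℂ}
    (hw : Measurable[dataFiltration hβ₀ hX hY n] w) (hw1 : ∀ ω, ‖w ω‖ ≤ 1)
    (hrule : FollowsPredictiveRule P PX β₀ X Y) (hR0 : 0 ≤ R) (hR : ∀ᵐ x ∂PX, ‖x‖ ≤ R)
    (t : Vec d) {βlim : Ω → Vec d}
    (hlim : ∀ᵐ ω ∂P, Tendsto (fun N => iterate β₀ X Y N ω) atTop (𝓝 (βlim ω))) :
    ‖∫ ω, w ω * Complex.exp ((inner ℝ (√n • (βlim ω - iterate β₀ X Y n ω)) t : ℝ) * Complex.I) ∂P -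
      ∫ ω, w ω * (Real.exp (-(stepVariance PX t (iterate β₀ X Y n ω) / 2)) : ℂ) ∂P‖ ≤
      rateConst R t / √n * ∫ ω, ‖w ω‖ ∂P := by
  have hn0 : (n : ℝ) ≠ 0 := by positivity
  have hw' : Measurable w := hw.mono ((dataFiltration hβ₀ hX hY).le n) le_rfl
  have hstart (ω : Ω) : dampedPhase PX β₀ X Y t n n ω =
      (Real.exp (-(stepVariance PX t (iterate β₀ X Y n ω) / 2)) : ℂ) := by
    simp [dampedPhase, hn0, div_eq_mul_inv]
  have htends : Tendsto (fun N => ∫ ω, w ω * dampedPhase PX β₀ X Y t n N ω ∂P) atTop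
      (𝓝 (∫ ω, w ω * Complex.exp
        ((inner ℝ (√n • (βlim ω - iterate β₀ X Y n ω)) t : ℝ) * Complex.I) ∂P)) := by
    refine tendsto_integral_of_dominated_convergence (fun _ => 1) (fun N =>
      (hw'.mul (measurable_dampedPhase hβ₀ hX hY hR0 hR t n N)).aestronglyMeasurable)
      (integrable_const _) (fun N => ae_of_all _ fun ω => ?_) ?_
    · rw [norm_mul]
      exact mul_le_one₀ (hw1 ω) (norm_nonneg _) (norm_dampedPhase_le t n N ω)
    · filter_upwards [hlim] with ω h
      have h1 : Tendsto (fun N : ℕ => (n : ℝ) / N / 2) atTop (𝓝 (0 / 2)) :=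
        (tendsto_const_div_atTop_nhds_zero_nat (n : ℝ)).div_const 2
      have h2 : Tendsto (fun N : ℕ => Real.exp
          (-(stepVariance PX t (iterate β₀ X Y n ω) * (n / N / 2)))) atTop (𝓝 1) := by
        have := (Real.continuous_exp.tendsto _).comp
          (h1.const_mul (stepVariance PX t (iterate β₀ X Y n ω))).neg
        simpa [Function.comp_def] using this
      have h3 : Tendsto (fun N => √(n : ℝ) * inner ℝ (iterate β₀ X Y N ω - iterate β₀ X Y n ω) t)
          atTop (𝓝 (√n * inner ℝ (βlim ω - iterate β₀ X Y n ω) t)) :=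
        ((h.sub_const _).inner tendsto_const_nhds).const_mul _
      have h4 := ((Complex.continuous_exp.tendsto _).comp
        (((Complex.continuous_ofReal.tendsto _).comp h3).mul_const Complex.I)).mul
        ((Complex.continuous_ofReal.tendsto _).comp h2)
      have h5 := h4.const_mul (w ω)
      rw [Complex.ofReal_one, mul_one] at h5
      rw [inner_smul_left]
      exact h5
  simp_rw [← hstart]
  refine le_of_tendsto (htends.sub_const _).norm ?_
  filter_upwards [eventually_ge_atTop n] with N hN
  refine (norm_integral_dampedPhase_sub_le hβ₀ hX hY hn hN hw hw1 hrule hR0 hR t).trans ?_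
  refine mul_le_mul_of_nonneg_left ?_ (div_nonneg (rateConst_nonneg hR0 t) (Real.sqrt_nonneg _))
  refine mul_le_of_le_one_left (integral_nonneg fun _ => norm_nonneg _) ?_
  have : (0 : ℝ) ≤ n / N := by positivity
  linarith

end CharFun

end OnlineGradient

/-- A function measurable for a sub-`σ`-algebra is bounded by `δ` a.e. as soon as its integral
against every bounded weight `w` of that `σ`-algebra is at most `δ ∫ ‖w‖`. -/
theorem ae_norm_le_of_forall_norm_integral_mul_le {Ω : Type*} {m m0 : MeasurableSpace Ω}
    (hm : m ≤ m0) {P : Measure Ω} [IsFiniteMeasure P] {φ : Ω → ℂ} (hφ : Measurable[m] φ)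
    (hint : Integrable φ P) {δ : ℝ} (hδ : 0 ≤ δ)
    (h : ∀ w : Ω → ℂ, Measurable[m] w → (∀ ω, ‖w ω‖ ≤ 1) →
      ‖∫ ω, w ω * φ ω ∂P‖ ≤ δ * ∫ ω, ‖w ω‖ ∂P) :
    ∀ᵐ ω ∂P, ‖φ ω‖ ≤ δ := by
  set s : Set Ω := {ω | δ < ‖φ ω‖} with hs
  have hsm : MeasurableSet[m] s := measurableSet_lt measurable_const (measurable_norm.comp hφ)
  have hsm0 : MeasurableSet s := hm _ hsm
  -- The weight cancels the phase of `φ` on the bad set, so that `w * φ` is `‖φ‖` there and zero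
  -- elsewhere.
  set w : Ω → ℂ := s.indicator fun ω => (starRingEnd ℂ) (φ ω) / (‖φ ω‖ : ℂ) with hw
  have hwm : Measurable[m] w :=
    Measurable.indicator ((RCLike.continuous_conj.measurable.comp hφ).div
      (Complex.measurable_ofReal.comp (measurable_norm.comp hφ))) hsm
  have hwn (ω : Ω) : ‖w ω‖ = s.indicator (fun _ => (1 : ℝ)) ω := by
    by_cases hω : ω ∈ s
    · have h0 : ‖φ ω‖ ≠ 0 := (hδ.trans_lt hω).ne'
      simp [hw, hω, h0]
    · simp [hw, hω]
  have hwφ (ω : Ω) : w ω * φ ω = ((s.indicator (fun ω => ‖φ ω‖) ω : ℝ) : ℂ) := by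
    by_cases hω : ω ∈ s
    · have h0 : (‖φ ω‖ : ℂ) ≠ 0 := by exact_mod_cast (hδ.trans_lt hω).ne'
      simp only [hw, hω, Set.indicator_of_mem]
      rw [div_mul_eq_mul_div, div_eq_iff h0, Complex.conj_mul']
      ring
    · simp [hw, hω]
  have hle := h w hwm fun ω => by
    rw [hwn, Set.indicator_apply]; split_ifs <;> simp
  simp_rw [hwφ, hwn] at hle
  rw [integral_complex_ofReal, Complex.norm_real] at hle
  have i1 : Integrable (s.indicator fun ω => ‖φ ω‖) P := hint.norm.indicator hsm0
  have i2 : Integrable (fun ω => δ * s.indicator (fun _ => (1 : ℝ)) ω) P :=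
    ((integrable_const _).indicator hsm0).const_mul _
  have hnn : ∀ ω, 0 ≤ s.indicator (fun ω => ‖φ ω‖) ω - δ * s.indicator (fun _ => (1 : ℝ)) ω := by
    intro ω
    by_cases hω : ω ∈ s
    · simpa [hω] using le_of_lt hω
    · simp [hω]
  -- The excess over `δ` is nonnegative, and the hypothesis makes its integral nonpositive; being
  -- strictly positive on `s`, it forces `s` to be null.
  have h0 : ∫ ω, (s.indicator (fun ω => ‖φ ω‖) ω - δ * s.indicator (fun _ => (1 : ℝ)) ω) ∂P = 0 := by
    refine le_antisymm ?_ (integral_nonneg hnn)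
    rw [integral_sub i1 i2, integral_const_mul, sub_nonpos]
    exact (le_abs_self _).trans hle
  rw [integral_eq_zero_iff_of_nonneg hnn (i1.sub i2)] at h0
  filter_upwards [h0] with ω hω
  by_contra hlt
  have hmem : ω ∈ s := not_le.1 hlt
  simp only [hmem, Set.indicator_of_mem, Pi.zero_apply, mul_one] at hω
  exact hlt (sub_eq_zero.1 hω).le

namespace OnlineGradient

/-! ### Almost sure convergence and the conditional limit law -/

section Convergence

variable {d : ℕ} {Ω : Type*} [MeasurableSpace Ω] {P : Measure Ω} [IsProbabilityMeasure P]
  {PX : Measure (Vec d)} [IsProbabilityMeasure PX]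
  {β₀ : Ω → Vec d} {X : ℕ → Ω → Vec d} {Y : ℕ → Ω → Fin 2} {R : ℝ}
  (hβ₀ : Measurable β₀) (hX : ∀ n, Measurable (X (n + 1)))
  (hY : ∀ n, Measurable (Y (n + 1)))

omit [IsProbabilityMeasure PX] in
include hβ₀ hX hY in
theorem integrable_iterate (hrule : FollowsPredictiveRule P PX β₀ X Y)
    (hR : ∀ᵐ x ∂PX, ‖x‖ ≤ R) (hβ₀_int : Integrable β₀ P) (n : ℕ) :
    Integrable (iterate β₀ X Y n) P := by
  obtain ⟨C, hC0, hC⟩ := exists_ae_norm_iterate_sub_le hβ₀ hX hY hrule hR n.zero_le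
  have h : Integrable (fun ω => iterate β₀ X Y n ω - iterate β₀ X Y 0 ω) P :=
    Integrable.of_bound ((measurable_iterate hβ₀ hX hY n).sub
      (measurable_iterate hβ₀ hX hY 0)).aestronglyMeasurable C hC
  have := h.add hβ₀_int
  refine this.congr (ae_of_all _ fun ω => ?_)
  simp [iterate]

theorem martingale_iterate_apply (hrule : FollowsPredictiveRule P PX β₀ X Y)
    (hR : ∀ᵐ x ∂PX, ‖x‖ ≤ R) (hβ₀_int : Integrable β₀ P) (i : Fin d) :
    Martingale (fun n ω => iterate β₀ X Y n ω i) (dataFiltration hβ₀ hX hY) P := by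
  have hint (n : ℕ) : Integrable (fun ω => iterate β₀ X Y n ω i) P :=
    (EuclideanSpace.proj (𝕜 := ℝ) i).integrable_comp
      (integrable_iterate hβ₀ hX hY hrule hR hβ₀_int n)
  refine martingale_of_setIntegral_eq_succ (fun n => ?_) hint fun n s hs => ?_
  · exact (((EuclideanSpace.proj (𝕜 := ℝ) i).continuous.measurable).comp
      (measurable_iterate_dataFiltration hβ₀ hX hY n)).stronglyMeasurable
  · have hs0 : MeasurableSet s := (dataFiltration hβ₀ hX hY).le n s hs
    set e : Vec d := EuclideanSpace.single i 1
    have hu : Measurable[dataFiltration hβ₀ hX hY n] (s.indicator fun _ => e) :=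
      Measurable.indicator measurable_const hs
    have h := integral_inner_iterate_increment hβ₀ hX hY hu (C := ‖e‖)
      (ae_of_all _ fun ω => norm_indicator_le_norm_self _ _) hrule hR
    -- An event `s` known at time `n` is absorbed into the test vector, so the martingale property
    -- is the centring of the increment against `s.indicator e`.
    have e1 (ω : Ω) : s.indicator (fun ω => iterate β₀ X Y (n + 1) ω i - iterate β₀ X Y n ω i) ω =
        1 / ((n : ℝ) + 1) * inner ℝ (increment (iterate β₀ X Y n ω) (X (n + 1) ω, Y (n + 1) ω))
          (s.indicator (fun _ => e) ω) := by
      by_cases hω : ω ∈ s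
      · simp only [hω, Set.indicator_of_mem, iterate_succ, e]
        rw [EuclideanSpace.inner_single_right]
        simp
      · simp [hω]
    symm
    rw [← sub_eq_zero, ← integral_sub (hint _).integrableOn (hint _).integrableOn,
      ← integral_indicator hs0]
    simp_rw [e1]
    rw [integral_const_mul, h, mul_zero]

include hβ₀ hX hY in
theorem exists_ae_tendsto_iterate (hrule : FollowsPredictiveRule P PX β₀ X Y)
    (hR : ∀ᵐ x ∂PX, ‖x‖ ≤ R) (hβ₀_int : Integrable β₀ P) :
    ∃ βlim : Ω → Vec d, Measurable βlim ∧
      ∀ᵐ ω ∂P, Tendsto (fun n => iterate β₀ X Y n ω) atTop (𝓝 (βlim ω)) := by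
  have hint := integrable_iterate hβ₀ hX hY hrule hR hβ₀_int
  -- The displacement estimate starts from a positive time, so it is anchored at time `1`; the time
  -- `0` norm is added to cover `n = 0`.
  set K : ℝ := (∫ ω, ‖iterate β₀ X Y 0 ω‖ ∂P) + (∫ ω, ‖iterate β₀ X Y 1 ω‖ ∂P) +
    (1 + (1 / Real.log 2 * R) ^ 2) / 2 with hK
  have hI (k : ℕ) : 0 ≤ ∫ ω, ‖iterate β₀ X Y k ω‖ ∂P := integral_nonneg fun _ => norm_nonneg _
  have hbound (n : ℕ) : ∫ ω, ‖iterate β₀ X Y n ω‖ ∂P ≤ K := by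
    rcases Nat.eq_zero_or_pos n with rfl | hn
    · have : 0 ≤ (1 + (1 / Real.log 2 * R) ^ 2) / 2 := by positivity
      linarith [hI 1]
    · have h := integral_mul_norm_iterate_sub_le hβ₀ hX hY le_rfl hn (w := fun _ => 1)
        measurable_const (by simp) (by simp) hrule hR
      simp only [one_mul, Nat.cast_one, Real.sqrt_one, div_one, integral_const, probReal_univ,
        smul_eq_mul, mul_one] at h
      have h2 : ∫ ω, ‖iterate β₀ X Y n ω‖ ∂P ≤
          ∫ ω, (‖iterate β₀ X Y 1 ω‖ + ‖iterate β₀ X Y n ω - iterate β₀ X Y 1 ω‖) ∂P :=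
        integral_mono (hint n).norm ((hint 1).norm.add ((hint n).sub (hint 1)).norm)
          fun ω => norm_le_norm_add_norm_sub' _ _
      have i1 : Integrable (fun ω => ‖iterate β₀ X Y n ω - iterate β₀ X Y 1 ω‖) P :=
        ((hint n).sub (hint 1)).norm
      rw [integral_add (hint 1).norm i1] at h2
      linarith [hI 0]
  have hcoord (i : Fin d) : ∀ᵐ ω ∂P, ∃ c, Tendsto (fun n => iterate β₀ X Y n ω i) atTop (𝓝 c) := by
    refine (martingale_iterate_apply hβ₀ hX hY hrule hR hβ₀_int i).submartingale.exists_ae_tendsto_of_bdd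
      (R := K.toNNReal) fun n => ?_
    have hi : Integrable (fun ω => iterate β₀ X Y n ω i) P :=
      (EuclideanSpace.proj (𝕜 := ℝ) i).integrable_comp (hint n)
    rw [eLpNorm_one_eq_lintegral_enorm, ← ofReal_integral_norm_eq_lintegral_enorm hi]
    refine ENNReal.ofReal_le_ofReal (le_trans ?_ (hbound n))
    exact integral_mono hi.norm (hint n).norm fun ω => PiLp.norm_apply_le _ i
  have hex : ∀ᵐ ω ∂P, ∃ l, Tendsto (fun n => iterate β₀ X Y n ω) atTop (𝓝 l) := by
    filter_upwards [ae_all_iff.2 hcoord] with ω hω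
    choose c hc using hω
    refine ⟨WithLp.toLp 2 c, ?_⟩
    exact ((PiLp.continuous_toLp 2 _).tendsto c).comp (tendsto_pi_nhds.2 hc)
  obtain ⟨l, hl, h⟩ := measurable_limit_of_tendsto_metrizable_ae
    (fun n => (measurable_iterate hβ₀ hX hY n).aemeasurable) hex
  exact ⟨l, hl, h⟩

include hβ₀ hX hY in
-- Both terms of the difference are functions of the data up to time `n`, so it suffices to test
-- against bounded weights of that `σ`-algebra. Disintegration replaces the conditional
-- characteristic function by the phase of the limit, which is already controlled.
theorem ae_norm_charFun_scaledErrorLaw_sub_le (hrule : FollowsPredictiveRule P PX β₀ X Y)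
    (hR0 : 0 ≤ R) (hR : ∀ᵐ x ∂PX, ‖x‖ ≤ R) {βlim : Ω → Vec d} (hβlim : Measurable βlim)
    (hlim : ∀ᵐ ω ∂P, Tendsto (fun N => iterate β₀ X Y N ω) atTop (𝓝 (βlim ω)))
    {n : ℕ} (hn : 1 ≤ n) (t : Vec d) :
    ∀ᵐ ω ∂P, ‖charFun (scaledErrorLaw P β₀ X Y βlim n ω : Measure (Vec d)) t -
      (Real.exp (-(stepVariance PX t (iterate β₀ X Y n ω) / 2)) : ℂ)‖ ≤ rateConst R t / √n := by
  have hB := measurable_iterate hβ₀ hX hY n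
  have hH := measurable_history hβ₀ hX hY n
  have hHF := measurable_history_dataFiltration hβ₀ hX hY n
  set H := history β₀ X Y n
  set Z : Ω → Vec d := fun ω => √n • (βlim ω - iterate β₀ X Y n ω) with hZ
  have hZm : Measurable Z := (hβlim.sub hB).const_smul (√n : ℝ)
  let G : (Vec d × (Fin n → Vec d × Fin 2)) → ℂ := fun h => charFun (condDistrib Z H P h) t
  have hG : Measurable G := by
    refine StronglyMeasurable.measurable ?_
    simp only [G, charFun_apply]
    exact StronglyMeasurable.integral_kernel (by fun_prop : Measurable _).stronglyMeasurable
  have hv : Measurable fun b => (Real.exp (-(stepVariance PX t b / 2)) : ℂ) := by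
    have := (continuous_stepVariance hR0 hR t).measurable
    fun_prop
  have hGF := hG.comp hHF
  have hvF := hv.comp (measurable_iterate_dataFiltration hβ₀ hX hY n)
  have hle := (dataFiltration hβ₀ hX hY).le n
  have hGb (h) : ‖G h‖ ≤ 1 := norm_charFun_le_one _
  have hvb (b) : ‖(Real.exp (-(stepVariance PX t b / 2)) : ℂ)‖ ≤ 1 := by
    rw [Complex.norm_real, Real.norm_eq_abs, Real.abs_exp, Real.exp_le_one_iff, neg_nonpos]
    exact div_nonneg (stepVariance_nonneg _ _) zero_le_two
  have iG : Integrable (fun ω => G (H ω)) P :=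
    Integrable.of_bound (hG.comp hH).aestronglyMeasurable 1 (ae_of_all _ fun ω => hGb _)
  have iv : Integrable
      (fun ω => (Real.exp (-(stepVariance PX t (iterate β₀ X Y n ω) / 2)) : ℂ)) P :=
    Integrable.of_bound (hv.comp hB).aestronglyMeasurable 1 (ae_of_all _ fun ω => hvb _)
  refine ae_norm_le_of_forall_norm_integral_mul_le hle (hGF.sub hvF) (iG.sub iv)
    (div_nonneg (rateConst_nonneg hR0 t) (Real.sqrt_nonneg _)) fun w hw hw1 => ?_
  have hw' : Measurable w := hw.mono hle le_rfl
  have key : ∫ ω, w ω * G (H ω) ∂P =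
      ∫ ω, w ω * Complex.exp ((inner ℝ (Z ω) t : ℝ) * Complex.I) ∂P := by
    obtain ⟨a, ha, haw⟩ := hw.exists_eq_measurable_comp
    have i := integral_eq_integral_integral_condDistrib (μ := P) hH hZm.aemeasurable
      (f := fun p => a p.1 * Complex.exp ((inner ℝ p.2 t : ℝ) * Complex.I))
      (by fun_prop : Measurable _).stronglyMeasurable ?_
    · simp_rw [haw, Function.comp_apply]
      refine Eq.trans ?_ i.symm
      refine integral_congr_ae (ae_of_all _ fun ω => ?_)
      exact (integral_const_mul (a (H ω)) _).symm
    · have e (ω : Ω) : a (H ω) = w ω := by rw [haw]; rfl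
      simp only [e]
      refine Integrable.of_bound (by fun_prop) 1 (ae_of_all _ fun ω => ?_)
      rw [norm_mul, Complex.norm_exp_ofReal_mul_I, mul_one]
      exact hw1 ω
  have hmain := norm_integral_limit_phase_sub_le hβ₀ hX hY hn hw hw1 hrule hR0 hR t hlim
  rw [← key, ← integral_sub] at hmain
  · convert hmain using 4 with ω
    exact mul_sub _ _ _
  · refine Integrable.of_bound (hw'.mul (hG.comp hH)).aestronglyMeasurable 1
      (ae_of_all _ fun ω => ?_)
    rw [norm_mul]
    exact mul_le_one₀ (hw1 ω) (norm_nonneg _) (hGb _)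
  · refine Integrable.of_bound (hw'.mul (hv.comp hB)).aestronglyMeasurable 1
      (ae_of_all _ fun ω => ?_)
    rw [norm_mul]
    exact mul_le_one₀ (hw1 ω) (norm_nonneg _) (hvb _)

include hβ₀ hX hY in
-- The exceptional null set depends on `t`. Taking a countable dense set of `t` gives one null set,
-- and continuity of both sides in `t` extends the bound to all of them.
theorem ae_forall_norm_charFun_scaledErrorLaw_sub_le (hrule : FollowsPredictiveRule P PX β₀ X Y)
    (hR0 : 0 ≤ R) (hR : ∀ᵐ x ∂PX, ‖x‖ ≤ R) {βlim : Ω → Vec d} (hβlim : Measurable βlim)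
    (hlim : ∀ᵐ ω ∂P, Tendsto (fun N => iterate β₀ X Y N ω) atTop (𝓝 (βlim ω)))
    {n : ℕ} (hn : 1 ≤ n) :
    ∀ᵐ ω ∂P, ∀ t, ‖charFun (scaledErrorLaw P β₀ X Y βlim n ω : Measure (Vec d)) t -
      (Real.exp (-(stepVariance PX t (iterate β₀ X Y n ω) / 2)) : ℂ)‖ ≤ rateConst R t / √n := by
  filter_upwards [ae_all_iff.2 fun k => ae_norm_charFun_scaledErrorLaw_sub_le hβ₀ hX hY hrule hR0
    hR hβlim hlim hn (TopologicalSpace.denseSeq (Vec d) k)] with ω hω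
  have hv := continuous_stepVariance_left hR (iterate β₀ X Y n ω)
  have hc : Continuous (charFun (scaledErrorLaw P β₀ X Y βlim n ω : Measure (Vec d))) :=
    continuous_charFun
  have hr := continuous_rateConst (d := d) (R := R)
  have hclosed : IsClosed {t | ‖charFun (scaledErrorLaw P β₀ X Y βlim n ω : Measure (Vec d)) t -
      (Real.exp (-(stepVariance PX t (iterate β₀ X Y n ω) / 2)) : ℂ)‖ ≤ rateConst R t / √n} :=
    isClosed_le (by fun_prop) (by fun_prop)
  have huniv := (TopologicalSpace.denseRange_denseSeq (Vec d)).closure_eq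
  intro t
  exact closure_minimal (Set.range_subset_iff.2 hω) hclosed (huniv ▸ Set.mem_univ t)

/-- A deterministic statement, applied for each fixed `ω`: the rate vanishes, the variance is
continuous in the parameter, and Lévy's theorem applies. -/
theorem tendsto_normalLaw_of_norm_charFun_sub_le (hR0 : 0 ≤ R) (hR : ∀ᵐ x ∂PX, ‖x‖ ≤ R)
    {κ : ℕ → ProbabilityMeasure (Vec d)} {b : ℕ → Vec d} {l : Vec d}
    (hb : Tendsto b atTop (𝓝 l))
    (h : ∀ n, 1 ≤ n → ∀ t, ‖charFun (κ n : Measure (Vec d)) t -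
      (Real.exp (-(stepVariance PX t (b n) / 2)) : ℂ)‖ ≤ rateConst R t / √n) :
    Tendsto κ atTop (𝓝 (normalLaw (asympCov PX l))) := by
  refine ProbabilityMeasure.tendsto_of_tendsto_charFun fun t => ?_
  have hchar : charFun (normalLaw (asympCov PX l) : Measure (Vec d)) t =
      (Real.exp (-(stepVariance PX t l / 2)) : ℂ) := by
    rw [normalLaw, ProbabilityMeasure.coe_mk, charFun_multivariateGaussian (posSemidef_asympCov hR l),
      dotProduct_asympCov_mulVec hR]
    simp
  rw [hchar]
  have h1 : Tendsto (fun n => (Real.exp (-(stepVariance PX t (b n) / 2)) : ℂ)) atTop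
      (𝓝 (Real.exp (-(stepVariance PX t l / 2)) : ℂ)) := by
    have hv := continuous_stepVariance hR0 hR t
    have : Continuous fun b => (Real.exp (-(stepVariance PX t b / 2)) : ℂ) := by fun_prop
    exact (this.tendsto l).comp hb
  have h2 : Tendsto (fun n : ℕ => rateConst R t / √n) atTop (𝓝 0) :=
    tendsto_const_nhds.div_atTop (Real.tendsto_sqrt_atTop.comp tendsto_natCast_atTop_atTop)
  have h3 := squeeze_zero_norm' (a := fun n : ℕ => rateConst R t / √n)
    (f := fun n => charFun (κ n : Measure (Vec d)) t -
      (Real.exp (-(stepVariance PX t (b n) / 2)) : ℂ))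
    (by filter_upwards [eventually_ge_atTop 1] with n hn using h n hn t) h2
  simpa using h3.add h1

end Convergence

end OnlineGradient

end

theorem mainTheorem6 {d : ℕ} {Ω : Type*} [MeasurableSpace Ω] (P : Measure Ω)
    [IsProbabilityMeasure P] (PX : Measure (OnlineGradient.Vec d)) [IsProbabilityMeasure PX]
    (β₀ : Ω → OnlineGradient.Vec d) (X : ℕ → Ω → OnlineGradient.Vec d) (Y : ℕ → Ω → Fin 2)
    (hβ₀ : Measurable β₀) (hX : ∀ n, Measurable (X (n + 1))) (hY : ∀ n, Measurable (Y (n + 1)))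
    (hrule : OnlineGradient.FollowsPredictiveRule P PX β₀ X Y)
    (hβ₀_sq : Integrable (fun ω => ‖β₀ ω‖ ^ 2) P)
    (hbdd : Bornology.IsBounded PX.support)
    (hnondeg : ∀ L : Submodule ℝ (OnlineGradient.Vec d), L ≠ ⊤ → PX (L : Set _) < 1) :
    ∃ βlim : Ω → OnlineGradient.Vec d, Measurable βlim ∧
      (∀ᵐ ω ∂P, Tendsto (fun n => OnlineGradient.iterate β₀ X Y n ω) atTop (𝓝 (βlim ω))) ∧
      ∀ᵐ ω ∂P, Tendsto (fun n => OnlineGradient.scaledErrorLaw P β₀ X Y βlim n ω) atTop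
        (𝓝 (OnlineGradient.normalLaw (OnlineGradient.asympCov PX (βlim ω)))) := by
  obtain ⟨R, hR0, hRs⟩ := hbdd.exists_pos_norm_le
  have hR : ∀ᵐ x ∂PX, ‖x‖ ≤ R := by
    filter_upwards [Measure.support_mem_ae] with x hx using hRs x hx
  have hβ₀_int : Integrable β₀ P :=
    ((memLp_two_iff_integrable_sq_norm hβ₀.aestronglyMeasurable).2 hβ₀_sq).integrable one_le_two
  obtain ⟨βlim, hmeas, hlim⟩ :=
    OnlineGradient.exists_ae_tendsto_iterate hβ₀ hX hY hrule hR hβ₀_int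
  refine ⟨βlim, hmeas, hlim, ?_⟩
  -- Indexing by `k + 1` respects `1 ≤ n`; countably many exceptional null sets are merged.
  have hall := ae_all_iff.2 fun k : ℕ =>
    OnlineGradient.ae_forall_norm_charFun_scaledErrorLaw_sub_le hβ₀ hX hY hrule hR0.le hR hmeas
      hlim (Nat.le_add_left 1 k)
  filter_upwards [hlim, hall] with ω h1 h2
  refine OnlineGradient.tendsto_normalLaw_of_norm_charFun_sub_le hR0.le hR h1 fun n hn => ?_
  obtain ⟨k, rfl⟩ := Nat.exists_eq_add_of_le' hn
  exact h2 k
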